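/- **Definitions.** Let $k\ge 2$. A $k$-graph is a finite $k$-uniform hypergraph; $v(H)$ and $e(H)$ denote its numbers of vertices and edges, it is non-empty if $e(H)\ge 1$, and $J\subseteq H$ ranges over all subgraphs of $H$ (a subset of the vertices together with a set of edges of $H$ contained in that subset). Write $K_k$ for the $k$-graph with $k$ vertices and one edge. Put - $d(H)=e(H)/v(H)$ if $v(H)\ge 1$ and $d(H)=0$ otherwise, and $m(H)=\max_{J\subseteq H} d(J)$; - $d_k(H)=\frac{e(H)-1}{v(H)-k}$ if $H$ is non-empty and $v(H)\ge k+1$, $d_k(H)=1/k$ if $H\cong K_k$, $d_k(H)=0$ otherwise, and $m_k(H)=\max_{J\subseteq H} d_k(J)$; - $d_k(H_1,H_2)=\frac{e(H_1)}{v(H_1)-k+1/m_k(H_2)}$ if $H_2$ is non-empty and $v(H_1)\ge k$, $d_k(H_1,H_2)=0$ otherwise, and $m_k(H_1,H_2)=\max_{J\subseteq H_1} d_k(J,H_2)$. $H$ is strictly $k$-balanced if $d_k(J)<m_k(H)$ for every proper subgraph $J\subsetneq H$; $H_1$ is strictly balanced with respect to $d_k(\cdot,H_2)$ if $d_k(J,H_2)<m_k(H_1,H_2)$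 for every proper subgraph $J\subsetneq H_1$. A pair $(H_1,H_2)$ with $m_k(H_1)\ge m_k(H_2)$ is a *heart* if $H_2$ is strictly $k$-balanced and, moreover, $H_1$ is strictly $k$-balanced in case $m_k(H_1)=m_k(H_2)$, and $H_1$ is strictly balanced with respect to $d_k(\cdot,H_2)$ in case $m_k(H_1)>m_k(H_2)$. Write $G\to(H_1,\dots,H_r)$ if for every colouring of the edges of $G$ with colours $1,\dots,r$ there are an $i$ and a copy of $H_i$ in $G$ all of whose edges have colour $i$. Let $G^k_{n,p}$ be the random $k$-graph on $n$ vertices in which each $k$-set of vertices is an edge independently with probability $p$. **Theorem.** Let $k\ge 2$ and $r\ge 2$, and let $H_1,\dots,H_r$ be non-empty $k$-graphs with $m_k(H_1)\ge\dots\ge m_k(H_r)$ and $m_k(H_2)>1$ such that $(H_1,H_2)$ is a heart. Suppose that every $k$-graph $G$ with $m(G)\le m_k(H_1,H_2)$ satisfies $G\not\to(H_1,H_2)$. Then there is a constant $b>0$ such that for every function $p=p(n)\in[0,1]$ with $p(n)\le b\,n^{-1/m_k(H_1,H_2)}$ for all sufficiently large $n$, $$\lim_{n\to\infty}\mathbb{P}\bigl[G^k_{n,p}\to(H_1,\dots,H_r)\bigr]=0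 .$$ -/

import Mathlib

open Filter Topology

universe u w

/-- A finite `k`-uniform hypergraph (a `k`-graph): a finite vertex type `V` and a finite set of
edges, each of which is a set of exactly `k` vertices. -/
structure KGraph (k : ℕ) : Type (u + 1) where
  V : Type u
  [fintypeV : Fintype V]
  edges : Finset (Finset V)
  card_edge : ∀ e ∈ edges, e.card = k

attribute [instance] KGraph.fintypeV

namespace KGraph

variable {k : ℕ}

/-- A subgraph `J ⊆ H`: a set of vertices of `H` together with a set of edges of `H`, each of
which lies inside the chosen vertex set (isolated vertices and the empty subgraph are allowed). -/
@[ext]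
structure Sub (H : KGraph.{u} k) where
  verts : Finset H.V
  edges : Finset (Finset H.V)
  edges_subset : edges ⊆ H.edges
  subset_verts : ∀ e ∈ edges, e ⊆ verts

/-- `J` is a proper subgraph of `H`: it misses a vertex or an edge. -/
def Sub.IsProper {H : KGraph.{u} k} (J : H.Sub) : Prop :=
  J.verts ≠ Finset.univ ∨ J.edges ≠ H.edges

instance (H : KGraph.{u} k) : Finite H.Sub :=
  Finite.of_injective (fun J : H.Sub => (J.verts, J.edges)) fun _ _ h =>
    Sub.ext (congrArg Prod.fst h) (congrArg Prod.snd h)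

instance (H : KGraph.{u} k) : Nonempty H.Sub :=
  ⟨⟨∅, ∅, by simp, by simp⟩⟩

/-- A supremum over the subgraphs of a `k`-graph is a maximum. -/
theorem isGreatest_iSup_sub (H : KGraph.{u} k) (f : H.Sub → ℝ) :
    IsGreatest (Set.range f) (⨆ J, f J) :=
  ⟨(Set.range_nonempty f).csSup_mem (Set.finite_range f),
    fun _ hx => le_csSup (Set.finite_range f).bddAbove hx⟩

/-! The densities below depend only on the number `v` of vertices and the number `e` of edges. -/

/-- `d`: the ratio `e / v`, and `0` if there is no vertex. -/
noncomputable def d (v e : ℕ) : ℝ :=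
  if 1 ≤ v then (e : ℝ) / (v : ℝ) else 0

/-- `d_k`: `(e - 1) / (v - k)` if there is an edge and `v ≥ k + 1`, `1 / k` for a single edge on
`k` vertices, and `0` otherwise. -/
noncomputable def dK (k v e : ℕ) : ℝ :=
  if 1 ≤ e ∧ k + 1 ≤ v then ((e : ℝ) - 1) / ((v : ℝ) - (k : ℝ))
  else if v = k ∧ e = 1 then 1 / (k : ℝ)
  else 0

/-- The `m`-density `m(H)`, the maximum of `d(J)` over `J ⊆ H`. -/
noncomputable def m (H : KGraph.{u} k) : ℝ :=
  ⨆ J : H.Sub, d J.verts.card J.edges.card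

/-- The `k`-density `m_k(H)`, the maximum of `d_k(J)` over `J ⊆ H`. -/
noncomputable def mK (H : KGraph.{u} k) : ℝ :=
  ⨆ J : H.Sub, dK k J.verts.card J.edges.card

open Classical in
/-- `d_k(J, H₂)` for a `k`-graph `J` with `v` vertices and `e` edges:
`e / (v - k + 1 / m_k(H₂))` if `H₂` has an edge and `v ≥ k`, and `0` otherwise. -/
noncomputable def dKPair (v e : ℕ) (H₂ : KGraph.{w} k) : ℝ :=
  if H₂.edges.Nonempty ∧ k ≤ v then (e : ℝ) / ((v : ℝ) - (k : ℝ) + 1 / H₂.mK)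
  else 0

/-- The asymmetric `k`-density `m_k(H₁, H₂)`, the maximum of `d_k(J, H₂)` over `J ⊆ H₁`. -/
noncomputable def mKPair (H₁ : KGraph.{u} k) (H₂ : KGraph.{w} k) : ℝ :=
  ⨆ J : H₁.Sub, dKPair J.verts.card J.edges.card H₂

/-- `H` is strictly `k`-balanced. -/
def StrictlyKBalanced (H : KGraph.{u} k) : Prop :=
  ∀ J : H.Sub, J.IsProper → dK k J.verts.card J.edges.card < H.mK

/-- `H₁` is strictly balanced with respect to `d_k(·, H₂)`. -/
def StrictlyBalancedWrt (H₁ : KGraph.{u} k) (H₂ : KGraph.{w} k) : Prop :=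
  ∀ J : H₁.Sub, J.IsProper → dKPair J.verts.card J.edges.card H₂ < mKPair H₁ H₂

/-- `(H₁, H₂)` is a heart. -/
def IsHeart (H₁ : KGraph.{u} k) (H₂ : KGraph.{w} k) : Prop :=
  H₂.mK ≤ H₁.mK ∧
  H₂.StrictlyKBalanced ∧
  (H₁.mK = H₂.mK → H₁.StrictlyKBalanced) ∧
  (H₂.mK < H₁.mK → H₁.StrictlyBalancedWrt H₂)

/-- `G → (H₁, …, H_r)`: for every colouring of the edges of `G` with `r` colours there are a
colour `i` and a copy of `H i` in `G` (the image of an injection of the vertices that maps edges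
to edges) all of whose edges have colour `i`. -/
def Arrows (G : KGraph.{w} k) {r : ℕ} (H : Fin r → KGraph.{u} k) : Prop :=
  ∀ c : {e // e ∈ G.edges} → Fin r, ∃ i : Fin r, ∃ f : (H i).V ↪ G.V,
    ∀ e ∈ (H i).edges, ∃ he : e.map f ∈ G.edges, c ⟨e.map f, he⟩ = i

/-- The `k`-graph on the vertex set `Fin n` with edge set `E`. -/
def onFin (k n : ℕ) (E : Finset {e : Finset (Fin n) // e.card = k}) : KGraph.{0} k where
  V := Fin n
  edges := E.map (Function.Embedding.subtype _)
  card_edge := by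
    intro e he
    obtain ⟨x, -, rfl⟩ := Finset.mem_map.1 he
    exact x.2

open Classical in
/-- The probability that the binomial random `k`-graph `G^k_{n,p}` has the property `P`: each
`k`-subset of the `n` vertices is an edge independently with probability `p`, so that the outcome
with edge set `E` has probability `p ^ |E| * (1 - p) ^ |Eᶜ|`. -/
noncomputable def binomialProb (k n : ℕ) (p : ℝ) (P : KGraph.{0} k → Prop) : ℝ :=
  ∑ E : Finset {e : Finset (Fin n) // e.card = k},
    if P (onFin k n E) then p ^ E.card * (1 - p) ^ Eᶜ.card else 0

end KGraph

/-! Put μ = 1/m_k(H₁,H₂) and ν = 1/m_k(H₂), so that μ ≤ ν < 1, and weigh an edge set X by |V(X)| -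
μ|X|, the exponent of n in the expected number of copies of X at p = n^(-μ). The heart hypothesis
makes every copy of H₁ and H₂ an `IsPiece`: it is strictly balanced and weighs k - ν, where H₂ is
weighed with ν in place of μ.

If the random k-graph arrows, a minimal family of copies without a good colouring is a core
(`Forces.exists_core`): every edge of a copy of one kind is its whole intersection with some copy of
the other kind. A core can therefore be explored by attaching flowers, a flower being a copy of H₂
(the centre) with a copy of H₁ (a petal) on each of its unexplored edges. If the flower meets the
explored part only in one edge, and its petals overlap no more than they must, the weight changes by
v₂ - k - ν(e₂ - 1) = 0. Any further overlap makes it drop (`flower_wt`), hence by at least a fixed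
ε, and costs a factor n^(-ε).

The union bound must survive about log n weight-neutral steps, each gaining only a constant factor
b, although the number of places to attach grows with the explored part. Fresh vertices resolve
this: as long as one exists, the state itself prescribes the edge of the next flower, and boundedly
many choices remain, which a small b absorbs. A regular step increases the number of fresh vertices,
and a degenerate one destroys boundedly many. Apart from the start, they can thus run out only
through degenerate steps, whose factor n^(-ε) pays for the polylogarithmic number of places
(`sum_succStates_le`).

By `exploration_outcome` three cases remain. About log n steps, or boundedly many steps of which D
are degenerate, or more generally any state with D degenerate steps, are unlikely by the union
bound. Otherwise the whole core lies in boundedly many edges. These arrow (H₁,H₂), so the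
deterministic hypothesis gives them density above m_k(H₁,H₂), that is, a bounded subgraph of
negative weight, and the first moment rules this out. -/

namespace KGraph

/-! ### Weights of edge sets, and overlaps of balanced pieces -/

section Pieces

variable {V : Type*} [DecidableEq V]

/-- The set of vertices covered by a set of edges. -/
def cov (X : Finset (Finset V)) : Finset V := X.biUnion id

theorem mem_cov {X : Finset (Finset V)} {x : V} : x ∈ cov X ↔ ∃ e ∈ X, x ∈ e := by
  simp [cov]

theorem subset_cov {X : Finset (Finset V)} {e : Finset V} (he : e ∈ X) : e ⊆ cov X :=
  fun _ hx => mem_cov.2 ⟨e, he, hx⟩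

theorem cov_mono {X Y : Finset (Finset V)} (h : X ⊆ Y) : cov X ⊆ cov Y :=
  Finset.biUnion_subset_biUnion_of_subset_left _ h

theorem cov_union (X Y : Finset (Finset V)) : cov (X ∪ Y) = cov X ∪ cov Y := by
  ext x; simp only [mem_cov, Finset.mem_union]; grind

theorem card_cov_le {k : ℕ} {X : Finset (Finset V)} (h : ∀ e ∈ X, e.card = k) :
    (cov X).card ≤ k * X.card := by
  rw [mul_comm]
  exact Finset.card_biUnion_le_card_mul _ _ _ fun e he => (h e he).le

/-- The exponent of `n` in the expected number of copies of `X`, at `p = n ^ (-μ)`. -/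
noncomputable def wt (μ : ℝ) (X : Finset (Finset V)) : ℝ := (cov X).card - μ * X.card

/-- A `k`-uniform edge set that is strictly balanced for the weight `|W| - μ * |J|`, the whole set
having weight `k - ν`. -/
structure IsPiece (k : ℕ) (μ ν : ℝ) (F : Finset (Finset V)) : Prop where
  uniform : ∀ e ∈ F, e.card = k
  lt_cov : k < (cov F).card
  wt_eq : ((cov F).card : ℝ) - μ * F.card = k - ν
  lt_wt : ∀ J W, J ⊂ F → cov J ⊆ W → W ⊆ cov F → k < W.card →
    (k : ℝ) - ν < W.card - μ * J.card

variable {k : ℕ} {μ ν : ℝ} {F S : Finset (Finset V)}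

/-- Two distinct `k`-sets span more than `k` vertices. This settles the boundary case of exactly `k`
common vertices, which `IsPiece.lt_wt` excludes. -/
theorem card_le_one_of_cov_subset {J : Finset (Finset V)} {W : Finset V}
    (hu : ∀ e ∈ J, e.card = k) (hJ : cov J ⊆ W) (hW : W.card ≤ k) : J.card ≤ 1 := by
  have key : ∀ e ∈ J, e = W := fun e he =>
    Finset.eq_of_subset_of_card_le ((subset_cov he).trans hJ) (by rw [hu e he]; exact hW)
  exact Finset.card_le_one.2 fun a ha b hb => (key a ha).trans (key b hb).symm

theorem IsPiece.two_lt_card (h : IsPiece k μ ν F) (hμ : 0 < μ) (hμν : μ ≤ ν) (hν : ν < 1) :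
    2 < F.card := by
  have h1 : (k : ℝ) + 1 ≤ (cov F).card := by exact_mod_cast h.lt_cov
  have h2 := h.wt_eq
  by_contra! h3
  have h4 : (F.card : ℝ) ≤ 2 := by exact_mod_cast h3
  nlinarith

/-- Minimum degree two: if `e` were the only edge at `x`, deleting both would change the weight by μ
- 1 < 0, against strict balancedness. The exploration uses it to find an unexplored edge at a fresh
vertex. -/
theorem IsPiece.exists_ne_mem (h : IsPiece k μ ν F) (hμ : 0 < μ) (hμν : μ ≤ ν) (hν : ν < 1)
    {x : V} (hx : x ∈ cov F) {e : Finset V} (he : e ∈ F) : ∃ g ∈ F, g ≠ e ∧ x ∈ g := by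
  by_contra! hno
  have hJ : F.erase e ⊂ F := Finset.erase_ssubset he
  have hcov : cov (F.erase e) ⊆ (cov F).erase x := by
    intro y hy
    obtain ⟨g, hg, hyg⟩ := mem_cov.1 hy
    rw [Finset.mem_erase] at hg ⊢
    refine ⟨?_, mem_cov.2 ⟨g, hg.2, hyg⟩⟩
    rintro rfl
    exact hno g hg.2 hg.1 hyg
  have hc1 : ((cov F).erase x).card + 1 = (cov F).card := Finset.card_erase_add_one hx
  have hc2 : (F.erase e).card + 1 = F.card := Finset.card_erase_add_one he
  have hlt := h.lt_cov
  rcases Nat.lt_or_ge k ((cov F).erase x).card with h1 | h1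
  · have h2 := h.lt_wt _ _ hJ hcov (Finset.erase_subset _ _) h1
    have h3 := h.wt_eq
    rw [← hc1, ← hc2] at h3
    push_cast at h3
    linarith
  · have h2 := card_le_one_of_cov_subset
      (fun g hg => h.uniform g (Finset.mem_of_mem_erase hg)) hcov h1
    have := h.two_lt_card hμ hμν hν
    omega

theorem wt_union (S P : Finset (Finset V)) : wt μ (S ∪ P) =
    wt μ S + ((cov P).card - μ * P.card) - ((cov S ∩ cov P).card - μ * (S ∩ P).card) := by
  have h1 := Finset.card_union_add_card_inter S P
  have h2 := Finset.card_union_add_card_inter (cov S) (cov P)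
  rw [← cov_union] at h2
  have h1' : ((S ∪ P).card : ℝ) + (S ∩ P).card = S.card + P.card := by exact_mod_cast h1
  have h2' : ((cov (S ∪ P)).card : ℝ) + (cov S ∩ cov P).card = (cov S).card + (cov P).card := by
    exact_mod_cast h2
  unfold wt
  linear_combination h2' - μ * h1'

theorem cov_inter_subset (S P : Finset (Finset V)) : cov (S ∩ P) ⊆ cov S ∩ cov P :=
  Finset.subset_inter (cov_mono Finset.inter_subset_left) (cov_mono Finset.inter_subset_right)

theorem IsPiece.le_card_inter_cov (h : IsPiece k μ ν F) (hSF : (S ∩ F).Nonempty) :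
    k ≤ (cov S ∩ cov F).card := by
  obtain ⟨e, he⟩ := hSF
  rw [← h.uniform e (Finset.mem_of_mem_inter_right he)]
  exact Finset.card_le_card ((subset_cov he).trans (cov_inter_subset S F))

/-- The weight changes by k - ν minus the weight of the overlap. On more than `k` vertices the
overlap weighs more than k - ν by balancedness; on exactly `k` vertices it has at most one edge and
weighs at least k - μ. -/
theorem IsPiece.wt_union_lt (h : IsPiece k μ ν F) (hμ : 0 < μ)
    (hSF : (S ∩ F).Nonempty) (hF : ¬ F ⊆ S)
    (hs : μ < ν ∨ k < (cov S ∩ cov F).card) : wt μ (S ∪ F) < wt μ S := by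
  rw [wt_union, h.wt_eq]
  rcases (h.le_card_inter_cov hSF).lt_or_eq with hk | hk
  · have hss : S ∩ F ⊂ F :=
      ⟨Finset.inter_subset_right, fun hh => hF (hh.trans Finset.inter_subset_left)⟩
    have := h.lt_wt _ _ hss (cov_inter_subset S F) Finset.inter_subset_right hk
    linarith
  · have h1 := card_le_one_of_cov_subset
      (fun g hg => h.uniform g (Finset.mem_of_mem_inter_right hg)) (cov_inter_subset S F) hk.ge
    have h2 : ((S ∩ F).card : ℝ) ≤ 1 := by exact_mod_cast h1
    rw [← hk]
    have h3 : μ < ν := hs.resolve_right (by omega)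
    nlinarith

theorem IsPiece.wt_union_le (h : IsPiece k μ ν F) (hμ : 0 < μ) (hμν : μ ≤ ν)
    (hSF : (S ∩ F).Nonempty) : wt μ (S ∪ F) ≤ wt μ S := by
  by_cases hF : F ⊆ S
  · rw [Finset.union_eq_left.2 hF]
  by_cases hs : μ < ν ∨ k < (cov S ∩ cov F).card
  · exact (h.wt_union_lt hμ hSF hF hs).le
  push Not at hs
  have hk := le_antisymm hs.2 (h.le_card_inter_cov hSF)
  have h1 := card_le_one_of_cov_subset
    (fun g hg => h.uniform g (Finset.mem_of_mem_inter_right hg)) (cov_inter_subset S F) hs.2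
  have h2 : ((S ∩ F).card : ℝ) ≤ 1 := by exact_mod_cast h1
  rw [wt_union, h.wt_eq, hk]
  nlinarith

theorem wt_union_biUnion_le (hμ : 0 < μ) (hμν : μ ≤ ν) {X : Finset (Finset V)}
    {P : Finset V → Finset (Finset V)} (B : Finset (Finset V))
    (hP : ∀ e ∈ B, IsPiece k μ ν (P e) ∧ e ∈ P e ∧ e ∈ X) : wt μ (X ∪ B.biUnion P) ≤ wt μ X := by
  induction B using Finset.induction_on with
  | empty => simp
  | insert a B ha ih =>
    have h1 := hP a (Finset.mem_insert_self a B)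
    rw [Finset.biUnion_insert, Finset.union_comm (P a), ← Finset.union_assoc]
    refine (h1.1.wt_union_le hμ hμν ⟨a, ?_⟩).trans
      (ih fun e he => hP e (Finset.mem_insert_of_mem he))
    simp [h1.2.1, h1.2.2]

theorem exists_maximal_subset {α : Type*} [DecidableEq α] (B C₀ : Finset α)
    (p : Finset α → Prop) (hC₀ : C₀ ⊆ B) (hp : p C₀) :
    ∃ C, C₀ ⊆ C ∧ C ⊆ B ∧ p C ∧ ∀ a ∈ B, a ∉ C → ¬ p (insert a C) := by
  classical
  obtain ⟨C, hC, hmax⟩ := Finset.exists_max_image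
    (B.powerset.filter fun C => C₀ ⊆ C ∧ p C) Finset.card
    ⟨C₀, by simp [hC₀, hp]⟩
  simp only [Finset.mem_filter, Finset.mem_powerset] at hC hmax
  refine ⟨C, hC.2.1, hC.1, hC.2.2, fun a ha haC hpa => ?_⟩
  have := hmax (insert a C) ⟨Finset.insert_subset ha hC.1,
    hC.2.1.trans (Finset.subset_insert _ _), hpa⟩
  rw [Finset.card_insert_of_notMem haC] at this
  omega

/-- Petals attached to the edges in `B` of the centre `F₂`: the weight drops by at least `ν` for
each petal, with equality only if the petals are as disjoint as possible. -/
theorem petals_wt {F₂ : Finset (Finset V)} (h₂ : IsPiece k ν ν F₂) (hμ : 0 < μ) (hμν : μ ≤ ν)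
    {P : Finset V → Finset (Finset V)} (n : ℕ) :
    ∀ (B : Finset (Finset V)) (U : Finset V), B.card = n → B ⊂ F₂ → cov F₂ ⊆ U →
    (∀ e ∈ B, IsPiece k μ ν (P e) ∧ P e ∩ F₂ = {e}) →
    ((cov (B.biUnion P) \ U).card : ℝ) - μ * (B.biUnion P).card < -(ν * B.card) ∨
    (((cov (B.biUnion P) \ U).card : ℝ) - μ * (B.biUnion P).card = -(ν * B.card) ∧
      ∀ e ∈ B, cov (P e) ∩ U = e ∧ ∀ e' ∈ B, e ≠ e' → cov (P e) ∩ cov (P e') ⊆ U) := by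
  induction n using Nat.strong_induction_on with
  | _ n ih =>
  intro B U hn hB hU hP
  have hmem : ∀ e ∈ B, e ∈ P e := fun e he =>
    Finset.mem_of_mem_inter_left (by rw [(hP e he).2]; exact Finset.mem_singleton_self e)
  rcases B.eq_empty_or_nonempty with rfl | ⟨a, ha⟩
  · right; simp [cov]
  -- A cluster of petals around `a`, maximal with joint weight at most k - ν. Adding a petal that
  -- shares an edge with it would not raise the weight, so the remaining petals are edge-disjoint
  -- from the cluster.
  obtain ⟨C, haC, hCB, hpC, hCmax⟩ := exists_maximal_subset B {a}
    (fun C => wt μ (C.biUnion P) ≤ k - ν) (by simpa using ha)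
    (by simpa [wt] using (hP a ha).1.wt_eq.le)
  rw [Finset.singleton_subset_iff] at haC
  have hdisj : Disjoint (C.biUnion P) ((B \ C).biUnion P) := by
    rw [Finset.disjoint_biUnion_right]
    intro e he
    rw [Finset.mem_sdiff] at he
    by_contra hnd
    rw [Finset.not_disjoint_iff_nonempty_inter] at hnd
    refine hCmax e he.1 he.2 ?_
    rw [Finset.biUnion_insert, Finset.union_comm]
    exact ((hP e he.1).1.wt_union_le hμ hμν hnd).trans hpC
  have hunion : B.biUnion P = C.biUnion P ∪ (B \ C).biUnion P := by
    rw [← Finset.union_biUnion, Finset.union_sdiff_of_subset hCB]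
  have hcardB : C.card + (B \ C).card = B.card := by
    rw [add_comm]; exact Finset.card_sdiff_add_card_eq_card hCB
  have hCpos : 0 < C.card := Finset.card_pos.2 ⟨a, haC⟩
  -- The cluster's vertices count as old for the other petals. The cluster itself gains at most k -
  -- ν - |cov C|; if |C| ≥ 2, balancedness of `F₂` makes this less than -ν|C|.
  set U' := U ∪ cov (C.biUnion P) with hU'
  have ih' := ih (B \ C).card (by omega) (B \ C) U' rfl
    (Finset.ssubset_of_subset_of_ssubset Finset.sdiff_subset hB)
    (hU.trans Finset.subset_union_left)
    (fun e he => hP e (Finset.mem_sdiff.1 he).1)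
  have hcardE : ((B.biUnion P).card : ℝ) = (C.biUnion P).card + ((B \ C).biUnion P).card := by
    rw [hunion, Finset.card_union_of_disjoint hdisj]; push_cast; ring
  have hcardV : ((cov (B.biUnion P) \ U).card : ℝ) = (cov (C.biUnion P) \ U).card +
      (cov ((B \ C).biUnion P) \ U').card := by
    have : cov (B.biUnion P) \ U =
        (cov (C.biUnion P) \ U) ∪ (cov ((B \ C).biUnion P) \ U') := by
      rw [hunion, cov_union, hU']; ext x; simp only [Finset.mem_sdiff, Finset.mem_union]; tauto
    rw [this, Finset.card_union_of_disjoint]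
    · push_cast; ring
    · rw [Finset.disjoint_left]; intro x; simp only [hU', Finset.mem_sdiff, Finset.mem_union]; tauto
  have hcardC : ((cov (C.biUnion P) \ U).card : ℝ) =
      (cov (C.biUnion P)).card - (cov (C.biUnion P) ∩ U).card := by
    have := Finset.card_sdiff_add_card_inter (cov (C.biUnion P)) U
    rw [← this]; push_cast; ring
  have hcovC : cov C ⊆ cov (C.biUnion P) ∩ U := by
    refine Finset.subset_inter (cov_mono fun e he => Finset.mem_biUnion.2 ⟨e, he, hmem e (hCB he)⟩)
      ((cov_mono (hCB.trans hB.1)).trans hU)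
  have hle : ((cov C).card : ℝ) ≤ (cov (C.biUnion P) ∩ U).card := by
    exact_mod_cast Finset.card_le_card hcovC
  have hB' : (B.card : ℝ) = C.card + (B \ C).card := by exact_mod_cast hcardB.symm
  have hgainle : ((cov ((B \ C).biUnion P) \ U').card : ℝ) - μ * ((B \ C).biUnion P).card ≤
      -(ν * (B \ C).card) := by
    rcases ih' with h | h
    · exact h.le
    · exact h.1.le
  unfold wt at hpC
  rcases Nat.lt_or_ge 1 C.card with hC1 | hC1
  · -- a cluster of at least two petals
    left
    have hk : k < (cov C).card := by
      by_contra! hk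
      have := card_le_one_of_cov_subset (J := C)
        (fun e he => h₂.uniform e (hB.1 (hCB he))) subset_rfl hk
      omega
    have := h₂.lt_wt C (cov C) (Finset.ssubset_of_subset_of_ssubset hCB hB) subset_rfl
      (cov_mono (hCB.trans hB.1)) hk
    rw [hcardE, hcardV, hB', hcardC]
    nlinarith
  · have hCa : C = {a} := by
      symm
      exact Finset.eq_of_subset_of_card_le (by simpa using haC) (by simpa using hC1)
    have hCc : (C.card : ℝ) = 1 := by rw [hCa]; simp
    have hk : ((cov C).card : ℝ) = k := by
      rw [hCa]; simp [cov, h₂.uniform a (hB.1 ha)]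
    rcases ih' with h | ⟨h, hreg⟩
    · left
      rw [hcardE, hcardV, hB', hcardC, hCc]
      linarith
    -- A single petal: equality requires it to meet `U` in exactly the `k` vertices of `a`.
    rcases hle.lt_or_eq with hlt | heq
    · left
      rw [hcardE, hcardV, hB', hcardC, hCc]
      linarith
    right
    have hPa := (hP a ha).1.wt_eq
    have hCP : C.biUnion P = P a := by rw [hCa]; simp
    have hcovCa : cov C = a := by rw [hCa]; simp [cov]
    refine ⟨?_, ?_⟩
    · rw [hcardE, hcardV, hB', hcardC, hCc, ← heq, hk, hCP]
      linarith
    have hreg_a : cov (P a) ∩ U = a := by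
      rw [← hCP]
      symm
      have := Finset.eq_of_subset_of_card_le hcovC (by exact_mod_cast heq.ge)
      rwa [hcovCa] at this
    have hreg' : ∀ e ∈ B, e ≠ a → e ∈ B \ C := fun e he hea => by
      rw [hCa]; simp [he, hea]
    have hsub : ∀ e ∈ B, e ⊆ U := fun e he => (subset_cov (hB.1 he)).trans hU
    have hrest : ∀ e ∈ B, e ≠ a → cov (P e) ∩ (U ∪ cov (P a)) = e := fun e he hea => by
      have := (hreg e (hreg' e he hea)).1
      rwa [hU', hCP] at this
    have haa : ∀ e ∈ B, e ≠ a → cov (P e) ∩ cov (P a) ⊆ U := fun e he hea x hx => by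
      refine hsub e he ?_
      rw [← hrest e he hea]
      simp only [Finset.mem_inter, Finset.mem_union] at hx ⊢
      exact ⟨hx.1, Or.inr hx.2⟩
    intro e he
    by_cases hea : e = a
    · subst hea
      refine ⟨hreg_a, fun e' he' hne => ?_⟩
      rw [Finset.inter_comm]
      exact haa e' he' (Ne.symm hne)
    · refine ⟨?_, fun e' he' hne => ?_⟩
      · apply Finset.Subset.antisymm
        · refine (Finset.inter_subset_inter_left
            (Finset.subset_union_left (s₂ := cov (P a)))).trans ?_
          exact (hrest e he hea).subset
        · refine Finset.subset_inter ?_ (hsub e he)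
          exact subset_cov (hmem e he)
      · by_cases hea' : e' = a
        · subst hea'; exact haa e he hea
        · have := (hreg e (hreg' e he hea)).2 e' (hreg' e' he' hea') hne
          intro x hx
          have hx2 := this hx
          refine hsub e he ?_
          rw [← hrest e he hea]
          rw [hU', hCP] at hx2
          exact Finset.mem_inter.2 ⟨(Finset.mem_inter.1 hx).1, hx2⟩

/-- The outcome of attaching the centre `F₂` and its petals to `S`: the weight drops, unless all
the intersections are as small as possible. -/
theorem flower_wt {F₂ : Finset (Finset V)} (h₂ : IsPiece k ν ν F₂) (hμ : 0 < μ) (hμν : μ ≤ ν)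
    (hν : ν < 1) {e₀ : Finset V} (he₀ : e₀ ∈ F₂) (he₀S : e₀ ∈ S) (hF₂S : ¬ F₂ ⊆ S)
    {P : Finset V → Finset (Finset V)}
    (hP : ∀ e ∈ F₂ \ S, IsPiece k μ ν (P e) ∧ P e ∩ F₂ = {e}) :
    wt μ (S ∪ (F₂ ∪ (F₂ \ S).biUnion P)) < wt μ S ∨
    (wt μ (S ∪ (F₂ ∪ (F₂ \ S).biUnion P)) = wt μ S ∧ cov F₂ ∩ cov S = e₀ ∧
      ∀ e ∈ F₂ \ S, cov (P e) ∩ (cov S ∪ cov F₂) = e ∧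
        ∀ e' ∈ F₂ \ S, e ≠ e' → cov (P e) ∩ cov (P e') ⊆ cov S ∪ cov F₂) := by
  have hmem : ∀ e ∈ F₂ \ S, e ∈ P e := fun e he =>
    Finset.mem_of_mem_inter_left (by rw [(hP e he).2]; exact Finset.mem_singleton_self e)
  -- `A` collects petals for as long as the weight ends up strictly below that of `S`. The remaining
  -- petals `B` are either all edge-disjoint from `SA`, or one of them meets it.
  obtain ⟨A, -, hAF, hA, hAmax⟩ := exists_maximal_subset (F₂ \ S) ∅
    (fun A => A = ∅ ∨ wt μ (S ∪ A.biUnion P) < wt μ S) (Finset.empty_subset _) (Or.inl rfl)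
  set SA := S ∪ A.biUnion P with hSA
  set B := (F₂ \ S) \ A with hBdef
  have hBF : B ⊆ F₂ \ S := Finset.sdiff_subset
  have hnotSA : ∀ e ∈ B, e ∉ SA := by
    intro e he heSA
    rw [hBdef, Finset.mem_sdiff] at he
    rcases Finset.mem_union.1 heSA with h | h
    · exact (Finset.mem_sdiff.1 he.1).2 h
    · obtain ⟨a, ha, hea⟩ := Finset.mem_biUnion.1 h
      have h1 : e ∈ P a ∩ F₂ := Finset.mem_inter.2 ⟨hea, (Finset.mem_sdiff.1 he.1).1⟩
      rw [(hP a (hAF ha)).2, Finset.mem_singleton] at h1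
      exact he.2 (h1 ▸ ha)
  have hwA : wt μ SA ≤ wt μ S := by
    rcases hA with rfl | h
    · simp [hSA]
    · exact h.le
  by_cases hall : ∀ e ∈ B, Disjoint SA (P e)
  · have hdisj : Disjoint SA (B.biUnion P) := (Finset.disjoint_biUnion_right _ _ _).2 hall
    have hunion : S ∪ (F₂ ∪ (F₂ \ S).biUnion P) = SA ∪ B.biUnion P := by
      have h1 : (F₂ \ S).biUnion P = A.biUnion P ∪ B.biUnion P := by
        rw [← Finset.union_biUnion, hBdef, Finset.union_sdiff_of_subset hAF]
      have h2 : F₂ ⊆ S ∪ (F₂ \ S).biUnion P := by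
        intro e he
        by_cases heS : e ∈ S
        · exact Finset.mem_union_left _ heS
        · have := Finset.mem_sdiff.2 ⟨he, heS⟩
          exact Finset.mem_union_right _ (Finset.mem_biUnion.2 ⟨e, this, hmem e this⟩)
      rw [hSA, Finset.union_assoc, ← h1]
      apply Finset.Subset.antisymm
      · exact Finset.union_subset Finset.subset_union_left
          (Finset.union_subset h2 Finset.subset_union_right)
      · exact Finset.union_subset_union_right Finset.subset_union_right
    rcases B.eq_empty_or_nonempty with hB | hB
    · left
      rw [hunion, hB, Finset.biUnion_empty, Finset.union_empty]
      refine hA.resolve_left ?_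
      rintro rfl
      rw [Finset.sdiff_empty] at hBdef
      exact hF₂S (Finset.sdiff_eq_empty_iff_subset.1 (hBdef.symm.trans hB))
    have hBss : B ⊂ F₂ := by
      refine ⟨hBF.trans Finset.sdiff_subset, fun h => ?_⟩
      exact (Finset.mem_sdiff.1 (hBF (h he₀))).2 he₀S
    have hpet := petals_wt h₂ hμ hμν B.card B (cov SA ∪ cov F₂) rfl hBss
      Finset.subset_union_right (fun e he => hP e (hBF he))
    set gain := ((cov (B.biUnion P) \ (cov SA ∪ cov F₂)).card : ℝ) - μ * (B.biUnion P).card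
      with hgain
    have hwt : wt μ (S ∪ (F₂ ∪ (F₂ \ S).biUnion P)) =
        wt μ SA + ((cov F₂).card - (cov SA ∩ cov F₂).card) + gain := by
      have hcov : cov (SA ∪ B.biUnion P) =
          (cov SA ∪ cov F₂) ∪ (cov (B.biUnion P) \ (cov SA ∪ cov F₂)) := by
        have : cov F₂ ⊆ cov (SA ∪ B.biUnion P) := by
          rw [← hunion]
          exact cov_mono (Finset.subset_union_left.trans Finset.subset_union_right)
        rw [cov_union] at this ⊢
        ext x
        have := @this x
        simp only [Finset.mem_union, Finset.mem_sdiff] at this ⊢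
        tauto
      have h1 := Finset.card_union_add_card_inter (cov SA) (cov F₂)
      have h1' : ((cov SA ∪ cov F₂).card : ℝ) + (cov SA ∩ cov F₂).card =
        (cov SA).card + (cov F₂).card := by exact_mod_cast h1
      rw [hunion, hgain]
      unfold wt
      rw [hcov, Finset.card_union_of_disjoint Finset.disjoint_sdiff,
        Finset.card_union_of_disjoint hdisj]
      push_cast
      linear_combination h1'
    have hJ : F₂ \ B ⊂ F₂ := Finset.sdiff_ssubset hBss.1 hB
    have hJe₀ : e₀ ∈ F₂ \ B := Finset.mem_sdiff.2
      ⟨he₀, fun h => (Finset.mem_sdiff.1 (hBF h)).2 he₀S⟩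
    have hJSA : F₂ \ B ⊆ SA := by
      intro e he
      rw [Finset.mem_sdiff, hBdef, Finset.mem_sdiff, Finset.mem_sdiff] at he
      by_cases heS : e ∈ S
      · exact Finset.mem_union_left _ heS
      · have heA : e ∈ A := by tauto
        exact Finset.mem_union_right _ (Finset.mem_biUnion.2 ⟨e, heA, hmem e (hAF heA)⟩)
    have hJcov : cov (F₂ \ B) ⊆ cov SA ∩ cov F₂ :=
      Finset.subset_inter (cov_mono hJSA) (cov_mono Finset.sdiff_subset)
    have hJcard : ((F₂ \ B).card : ℝ) = F₂.card - B.card := by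
      rw [Finset.cast_card_sdiff hBss.1]
    have hWk : k ≤ (cov SA ∩ cov F₂).card := by
      rw [← h₂.uniform e₀ he₀]
      exact Finset.card_le_card ((subset_cov hJe₀).trans hJcov)
    have h2eq := h₂.wt_eq
    have hgle : gain ≤ -(ν * B.card) := by
      rcases hpet with h | h
      exacts [h.le, h.1.le]
    -- The total change from `SA` is at most k - ν minus the ν-weight of the edges `F₂ \ B` on the
    -- common vertices of `SA` and `F₂`. This is negative unless those vertices are just the `k`
    -- vertices of `e₀`.
    rcases hWk.lt_or_eq with hk | hk
    · left
      have := h₂.lt_wt _ _ hJ hJcov Finset.inter_subset_right hk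
      rw [hJcard] at this
      rw [hwt]
      nlinarith
    have hJ1 := card_le_one_of_cov_subset
      (fun g hg => h₂.uniform g (Finset.mem_sdiff.1 hg).1) hJcov hk.ge
    have hJ1' : (F₂ \ B).card = 1 :=
      le_antisymm hJ1 (Finset.card_pos.2 ⟨e₀, hJe₀⟩)
    have hB1 : (F₂.card : ℝ) - B.card = 1 := by rw [← hJcard, hJ1']; simp
    have hk' : ((cov SA ∩ cov F₂).card : ℝ) = k := by exact_mod_cast hk.symm
    have hF₂c : (F₂.card : ℝ) = B.card + 1 := by linarith
    rw [hF₂c] at h2eq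
    rcases hpet with h | ⟨h, hreg⟩
    · left
      rw [hwt, hk']
      linarith
    rcases hA with hA | hA
    · right
      have hSAS : SA = S := by rw [hSA, hA]; simp
      have hBA : B = F₂ \ S := by rw [hBdef, hA]; simp
      rw [hBA, hSAS] at hreg
      refine ⟨?_, ?_, hreg⟩
      · rw [hwt, hk', hSAS]; linarith
      · rw [Finset.inter_comm, ← hSAS]
        symm
        refine Finset.eq_of_subset_of_card_le ((subset_cov hJe₀).trans hJcov) ?_
        rw [← hk, h₂.uniform e₀ he₀]
    · left
      rw [hwt, hk']
      linarith
  · left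
    push Not at hall
    obtain ⟨e, heB, hnd⟩ := hall
    rw [Finset.not_disjoint_iff_nonempty_inter] at hnd
    have heFS := hBF heB
    have hPe := (hP e heFS).1
    have heP := hmem e heFS
    have heA : e ∉ A := (Finset.mem_sdiff.1 heB).2
    have hins : S ∪ (insert e A).biUnion P = SA ∪ P e := by
      rw [Finset.biUnion_insert, hSA, Finset.union_comm (P e), Finset.union_assoc]
    have hnotlt : ¬ wt μ (SA ∪ P e) < wt μ S := fun h =>
      hAmax e heFS heA (Or.inr (by rw [hins]; exact h))
    -- Had `A` already lowered the weight, `P e` could be added to it, against maximality. So `A` is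
    -- empty, and `P e` meets `S` itself in an edge without a drop, which forces μ = ν and exactly
    -- `k` common vertices.
    rcases hA with hA | hA
    swap
    · exact absurd ((hPe.wt_union_le hμ hμν hnd).trans_lt hA) hnotlt
    have hSAS : SA = S := by rw [hSA, hA]; simp
    rw [hSAS] at hnotlt hnd
    have heS : e ∉ S := (Finset.mem_sdiff.1 heFS).2
    have heF₂ : e ∈ F₂ := (Finset.mem_sdiff.1 heFS).1
    have hns : ¬ (μ < ν ∨ k < (cov S ∩ cov (P e)).card) := fun hs =>
      hnotlt (hPe.wt_union_lt hμ hnd (fun h => heS (h heP)) hs)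
    push Not at hns
    have hμν' : μ = ν := le_antisymm hμν hns.1
    subst hμν'
    have h1 : wt μ (S ∪ F₂) ≤ wt μ S :=
      h₂.wt_union_le hμ le_rfl ⟨e₀, Finset.mem_inter.2 ⟨he₀S, he₀⟩⟩
    have heX : e ∈ S ∪ F₂ := Finset.mem_union_right _ heF₂
    -- Changing the order helps: once the centre is attached, `P e` meets the explored set in two
    -- edges, `e` and one from `S`, hence in more than `k` vertices.
    have h2 : wt μ (S ∪ F₂ ∪ P e) < wt μ (S ∪ F₂) := by
      refine hPe.wt_union_lt hμ ⟨e, Finset.mem_inter.2 ⟨heX, heP⟩⟩ ?_ (Or.inr ?_)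
      · intro hsub
        have h3 : P e ⊆ (S ∩ P e) ∪ {e} := by
          intro g hg
          rcases Finset.mem_union.1 (hsub hg) with h | h
          · exact Finset.mem_union_left _ (Finset.mem_inter.2 ⟨h, hg⟩)
          · rw [← (hP e heFS).2]
            exact Finset.mem_union_right _ (Finset.mem_inter.2 ⟨hg, h⟩)
        have h4 := card_le_one_of_cov_subset
          (fun g hg => hPe.uniform g (Finset.mem_of_mem_inter_right hg))
          (cov_inter_subset S (P e)) hns.2
        have h5 := Finset.card_le_card h3
        have h6 := Finset.card_union_le (S ∩ P e) {e}
        have h7 := hPe.two_lt_card hμ le_rfl hν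
        rw [Finset.card_singleton] at h6
        omega
      · obtain ⟨g, hg⟩ := hnd
        have hgS := Finset.mem_of_mem_inter_left hg
        have hgP := Finset.mem_of_mem_inter_right hg
        have hge : g ≠ e := fun h => heS (h ▸ hgS)
        by_contra! hle
        have := card_le_one_of_cov_subset (J := {g, e}) (k := k)
          (W := cov (S ∪ F₂) ∩ cov (P e)) (by
            intro x hx
            rw [Finset.mem_insert, Finset.mem_singleton] at hx
            rcases hx with rfl | rfl
            exacts [hPe.uniform _ hgP, hPe.uniform _ heP]) (by
            refine Finset.Subset.trans (cov_mono ?_) (cov_inter_subset (S ∪ F₂) (P e))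
            intro x hx
            rw [Finset.mem_insert, Finset.mem_singleton] at hx
            rcases hx with rfl | rfl
            · exact Finset.mem_inter.2 ⟨Finset.mem_union_left _ hgS, hgP⟩
            · exact Finset.mem_inter.2 ⟨heX, heP⟩) hle
        rw [Finset.card_pair hge] at this
        omega
    have h3 : S ∪ (F₂ ∪ (F₂ \ S).biUnion P) =
        (S ∪ F₂ ∪ P e) ∪ (F₂ \ S).biUnion P := by
      have : P e ⊆ (F₂ \ S).biUnion P := Finset.subset_biUnion_of_mem P heFS
      rw [Finset.union_assoc (S ∪ F₂), Finset.union_eq_right.2 this, Finset.union_assoc]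
    rw [h3]
    refine (wt_union_biUnion_le hμ le_rfl (k := k) (ν := μ) _ fun e' he' =>
      ⟨(hP e' he').1, hmem e' he', ?_⟩).trans_lt (h2.trans_le h1)
    exact Finset.mem_union_left _ (Finset.mem_union_right _ (Finset.mem_sdiff.1 he').1)

end Pieces

end KGraph

/-! ### Minimal families of copies without a good colouring -/

namespace KGraph

section Core

variable {V : Type*} [DecidableEq V]

/-- Every set `R` of red edges contains a member of `L₁` or misses a member of `L₂`. -/
def Forces (L₁ L₂ : Finset (Finset (Finset V))) : Prop :=
  ∀ R : Finset (Finset V), (∃ F ∈ L₁, F ⊆ R) ∨ ∃ F ∈ L₂, Disjoint F R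

/-- The properties of a minimal pair of families of copies that admits no good colouring. -/
structure IsCore (L₁ L₂ : Finset (Finset (Finset V))) : Prop where
  forces : Forces L₁ L₂
  left : ∀ F₁ ∈ L₁, ∀ e ∈ F₁, ∃ F₂ ∈ L₂, F₁ ∩ F₂ = {e}
  right : ∀ F₂ ∈ L₂, ∀ e ∈ F₂, ∃ F₁ ∈ L₁, F₁ ∩ F₂ = {e}
  closed : ∀ S : Finset (Finset V), (∀ F ∈ L₁ ∪ L₂, F ⊆ S ∨ Disjoint F S) →
    (∃ F ∈ L₁, F ⊆ S) → ∀ F ∈ L₁ ∪ L₂, F ⊆ S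

/-- A minimal forcing pair works. Deleting one copy admits a good colouring, in which that copy is
the only one violated; recolouring its edge `e` must then violate a copy of the other kind, and that
copy meets the first in `e` alone. If the family split over an edge set, good colourings of the two
parts could be glued. -/
theorem Forces.exists_core {C₁ C₂ : Finset (Finset (Finset V))} (h : Forces C₁ C₂) :
    ∃ L₁ ⊆ C₁, ∃ L₂ ⊆ C₂, IsCore L₁ L₂ := by
  obtain ⟨⟨L₁, L₂⟩, hle, hmin⟩ := exists_minimal_le_of_wellFoundedLT
    (fun x : Finset (Finset (Finset V)) × Finset (Finset (Finset V)) => Forces x.1 x.2)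
    (C₁, C₂) h
  have hF : Forces L₁ L₂ := hmin.prop
  have hnot : ∀ M₁ M₂, M₁ ⊆ L₁ → M₂ ⊆ L₂ → (M₁ ≠ L₁ ∨ M₂ ≠ L₂) →
      ∃ R : Finset (Finset V), (∀ F ∈ M₁, ¬ F ⊆ R) ∧ ∀ F ∈ M₂, ¬ Disjoint F R := by
    intro M₁ M₂ h₁ h₂ hne
    by_contra hcon
    have hM : Forces M₁ M₂ := by
      intro R
      by_contra hR
      push Not at hR
      exact hcon ⟨R, hR⟩
    have := hmin.le_of_le (y := (M₁, M₂)) hM ⟨h₁, h₂⟩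
    rcases hne with hne | hne
    · exact hne (h₁.antisymm this.1)
    · exact hne (h₂.antisymm this.2)
  refine ⟨L₁, hle.1, L₂, hle.2, hF, ?_, ?_, ?_⟩
  · intro F₁ hF₁ e he
    obtain ⟨R, hR₁, hR₂⟩ := hnot (L₁.erase F₁) L₂ (Finset.erase_subset _ _) subset_rfl
      (Or.inl (Finset.erase_ne_self.2 hF₁))
    have hred : ∀ F ∈ L₁, F ⊆ R → F = F₁ := fun F hF hFR => by
      by_contra hne
      exact hR₁ F (Finset.mem_erase.2 ⟨hne, hF⟩) hFR
    have hF₁R : F₁ ⊆ R := by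
      rcases hF R with ⟨F, hFL, hFR⟩ | ⟨F, hFL, hFR⟩
      · exact hred F hFL hFR ▸ hFR
      · exact absurd hFR (hR₂ F hFL)
    -- Turning `e` blue repairs `F₁`, so some copy in `L₂` becomes entirely blue; `e` was its only
    -- red edge.
    rcases hF (R.erase e) with ⟨F, hFL, hFR⟩ | ⟨F, hFL, hFR⟩
    · have := hred F hFL (hFR.trans (Finset.erase_subset _ _))
      subst this
      exact absurd (hFR he) (Finset.notMem_erase e R)
    · refine ⟨F, hFL, ?_⟩
      have hd : ∀ g ∈ F, g ∈ R → g = e := fun g hg hgR => by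
        by_contra hne
        exact Finset.disjoint_left.1 hFR hg (Finset.mem_erase.2 ⟨hne, hgR⟩)
      obtain ⟨g, hg, hgR⟩ := Finset.not_disjoint_iff.1 (hR₂ F hFL)
      have heF : e ∈ F := hd g hg hgR ▸ hg
      ext x
      rw [Finset.mem_inter, Finset.mem_singleton]
      exact ⟨fun hx => hd x hx.2 (hF₁R hx.1), fun hx => hx ▸ ⟨he, heF⟩⟩
  · intro F₂ hF₂ e he
    obtain ⟨R, hR₁, hR₂⟩ := hnot L₁ (L₂.erase F₂) subset_rfl (Finset.erase_subset _ _)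
      (Or.inr (Finset.erase_ne_self.2 hF₂))
    have hblue : ∀ F ∈ L₂, Disjoint F R → F = F₂ := fun F hF hFR => by
      by_contra hne
      exact hR₂ F (Finset.mem_erase.2 ⟨hne, hF⟩) hFR
    have hF₂R : Disjoint F₂ R := by
      rcases hF R with ⟨F, hFL, hFR⟩ | ⟨F, hFL, hFR⟩
      · exact absurd hFR (hR₁ F hFL)
      · exact hblue F hFL hFR ▸ hFR
    rcases hF (insert e R) with ⟨F, hFL, hFR⟩ | ⟨F, hFL, hFR⟩
    · refine ⟨F, hFL, ?_⟩
      have heF : e ∈ F := by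
        by_contra hne
        exact hR₁ F hFL ((Finset.subset_insert_iff_of_notMem hne).1 hFR)
      ext x
      rw [Finset.mem_inter, Finset.mem_singleton]
      refine ⟨fun hx => ?_, fun hx => hx ▸ ⟨heF, he⟩⟩
      exact (Finset.mem_insert.1 (hFR hx.1)).resolve_right (Finset.disjoint_left.1 hF₂R hx.2)
    · have := hblue F hFL (Finset.disjoint_of_subset_right (Finset.subset_insert _ _) hFR)
      subst this
      exact absurd (Finset.mem_insert_self e R) (Finset.disjoint_left.1 hFR he)
  · intro S hS ⟨F₁, hF₁, hF₁S⟩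
    by_contra! hcon
    obtain ⟨F₀, hF₀, hF₀S⟩ := hcon
    obtain ⟨R, hR₁, hR₂⟩ := hnot (L₁.filter (· ⊆ S)) (L₂.filter (· ⊆ S))
      (Finset.filter_subset _ _) (Finset.filter_subset _ _) (by
        rcases Finset.mem_union.1 hF₀ with h | h
        · exact Or.inl fun hh => hF₀S (Finset.filter_eq_self.1 hh F₀ h)
        · exact Or.inr fun hh => hF₀S (Finset.filter_eq_self.1 hh F₀ h))
    obtain ⟨R', hR'₁, hR'₂⟩ := hnot (L₁.filter (¬ · ⊆ S)) (L₂.filter (¬ · ⊆ S))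
      (Finset.filter_subset _ _) (Finset.filter_subset _ _)
      (Or.inl fun hh => Finset.filter_eq_self.1 hh F₁ hF₁ hF₁S)
    simp only [Finset.mem_filter, and_imp] at hR₁ hR₂ hR'₁ hR'₂
    -- Glue the colouring of the copies inside `S` to that of the copies disjoint from `S`.
    rcases hF ((R ∩ S) ∪ (R' \ S)) with ⟨F, hFL, hFR⟩ | ⟨F, hFL, hFR⟩
    · by_cases hFS : F ⊆ S
      · refine hR₁ F hFL hFS fun x hx => ?_
        have := hFR hx; have := hFS hx
        grind
      · have hd := (hS F (Finset.mem_union_left _ hFL)).resolve_left hFS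
        refine hR'₁ F hFL hFS fun x hx => ?_
        have := hFR hx; have := Finset.disjoint_left.1 hd hx
        grind
    · rw [Finset.disjoint_left] at hFR
      by_cases hFS : F ⊆ S
      · refine hR₂ F hFL hFS (Finset.disjoint_left.2 fun x hx => ?_)
        have := hFR hx; have := hFS hx
        grind
      · have hd := (hS F (Finset.mem_union_right _ hFL)).resolve_left hFS
        refine hR'₂ F hFL hFS (Finset.disjoint_left.2 fun x hx => ?_)
        have := hFR hx; have := Finset.disjoint_left.1 hd hx
        grind

end Core

end KGraph

/-! ### Exploring a core by regular and degenerate steps -/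

namespace KGraph

section Exploration

variable {V : Type*} [DecidableEq V]

/-- A state of the exploration: the explored edges, the set of fresh vertices (each of them lies
in a copy of `H₁` that contains all the explored edges at the vertex), and the number of
degenerate steps so far. -/
abbrev ExpState (V : Type*) := Finset (Finset V) × Finset V × ℕ

open Classical in
/-- The part of the explored vertex set to which the next regular step may be attached: an explored
edge with a fresh vertex if there is one, and everything otherwise. -/
noncomputable def anchor (S : Finset (Finset V)) (L : Finset V) : Finset V :=
  if h : ∃ e ∈ S, ∃ x ∈ L, x ∈ e then h.choose else if L = ∅ then cov S else ∅

theorem anchor_empty (S : Finset (Finset V)) : anchor S ∅ = cov S := by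
  simp [anchor]

theorem anchor_spec {S : Finset (Finset V)} {L : Finset V} (h : ∃ e ∈ S, ∃ x ∈ L, x ∈ e) :
    anchor S L ∈ S ∧ ∃ x ∈ L, x ∈ anchor S L := by
  rw [anchor, dif_pos h]
  exact h.choose_spec

/-- This must hold for every enumerated state, also for those violating `ExpInv`; hence the default
value `∅` of `anchor` when no explored edge meets the nonempty fresh set. -/
theorem card_anchor_le {k : ℕ} {S : Finset (Finset V)} {L : Finset V} (hS : ∀ e ∈ S, e.card = k)
    (hL : L ≠ ∅) : (anchor S L).card ≤ k := by
  by_cases h : ∃ e ∈ S, ∃ x ∈ L, x ∈ e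
  · exact (hS _ (anchor_spec h).1).le
  · rw [anchor, dif_neg h, if_neg hL]; simp

/-- `Q` may be added to `S`: at most `q` edges, attached within `A`, with at least one new edge,
the weight growing by at most `-δ`. -/
structure Grow (k : ℕ) (μ δ : ℝ) (q : ℕ) (S : Finset (Finset V)) (A : Finset V)
    (Q : Finset (Finset V)) : Prop where
  uniform : ∀ e ∈ Q, e.card = k
  card_le : Q.card ≤ q
  inter : cov Q ∩ cov S ⊆ A
  new : (Q \ S).Nonempty
  wt_le : ((cov Q \ cov S).card : ℝ) - μ * (Q \ S).card ≤ -δ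

open Classical in
/-- The states that may follow `σ`. -/
noncomputable def succStates [Fintype V] (k : ℕ) (μ ε : ℝ) (q : ℕ) (σ : ExpState V) :
    Finset (ExpState V) :=
  ((Finset.univ.filter fun c : Finset (Finset V) × Finset V =>
      Grow k μ 0 q σ.1 (anchor σ.1 σ.2.1) c.1 ∧ c.2 ⊆ cov c.1 \ cov σ.1 ∧ c.2.Nonempty).image
    fun c => (σ.1 ∪ c.1, (σ.2.1 \ cov c.1) ∪ c.2, σ.2.2)) ∪
  ((Finset.univ.filter fun Q : Finset (Finset V) => Grow k μ ε q σ.1 (cov σ.1) Q).image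
    fun Q => (σ.1 ∪ Q, σ.2.1 \ cov Q, σ.2.2 + 1))

open Classical in
/-- The states reachable in `t` steps. -/
noncomputable def reach [Fintype V] (k : ℕ) (μ ε : ℝ) (q : ℕ) (C : Finset (Finset (Finset V))) :
    ℕ → Finset (ExpState V)
  | 0 => C.image fun F => (F, ∅, 0)
  | t + 1 => (reach k μ ε q C t).biUnion (succStates k μ ε q)

/-- The invariant of the exploration. -/
structure ExpInv (E : Finset (Finset V)) (L₁ : Finset (Finset (Finset V)))
    (S : Finset (Finset V)) (L : Finset V) : Prop where
  sub : S ⊆ E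
  base : ∃ F ∈ L₁, F ⊆ S
  fresh : ∀ x ∈ L, (∃ g ∈ S, x ∈ g) ∧ ∃ P ∈ L₁, P ⊆ S ∧ ∀ g ∈ S, x ∈ g → g ∈ P
  indep : ∀ g ∈ S, ∀ x ∈ L, ∀ y ∈ L, x ∈ g → y ∈ g → x = y

variable {k q : ℕ} {μ ν ε : ℝ} {E S Q : Finset (Finset V)} {L : Finset V}
  {L₁ L₂ : Finset (Finset (Finset V))}

theorem ExpInv.union (h : ExpInv E L₁ S L) (hQ : Q ⊆ E) : ExpInv E L₁ (S ∪ Q) (L \ cov Q) := by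
  have key : ∀ g ∈ S ∪ Q, ∀ x ∈ L \ cov Q, x ∈ g → g ∈ S := fun g hg x hx hxg => by
    rcases Finset.mem_union.1 hg with h1 | h1
    · exact h1
    · exact absurd (subset_cov h1 hxg) (Finset.mem_sdiff.1 hx).2
  refine ⟨Finset.union_subset h.sub hQ, ?_, ?_, ?_⟩
  · obtain ⟨F, hF, hFS⟩ := h.base
    exact ⟨F, hF, hFS.trans Finset.subset_union_left⟩
  · intro x hx
    obtain ⟨⟨g, hg, hxg⟩, P, hP, hPS, hall⟩ := h.fresh x (Finset.mem_sdiff.1 hx).1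
    exact ⟨⟨g, Finset.mem_union_left _ hg, hxg⟩, P, hP, hPS.trans Finset.subset_union_left,
      fun g' hg' hxg' => hall g' (key g' hg' x hx hxg') hxg'⟩
  · intro g hg x hx y hy hxg hyg
    exact h.indep g (key g hg x hx hxg) x (Finset.mem_sdiff.1 hx).1 y (Finset.mem_sdiff.1 hy).1
      hxg hyg

theorem card_union_eq_add_card_sdiff {α : Type*} [DecidableEq α] (S Q : Finset α) :
    (S ∪ Q).card = S.card + (Q \ S).card := by
  rw [← Finset.card_union_of_disjoint Finset.disjoint_sdiff, Finset.union_sdiff_self_eq_union]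

theorem wt_union_eq (S Q : Finset (Finset V)) :
    wt μ (S ∪ Q) = wt μ S + (((cov Q \ cov S).card : ℝ) - μ * (Q \ S).card) := by
  unfold wt
  rw [cov_union, card_union_eq_add_card_sdiff, card_union_eq_add_card_sdiff]
  push_cast
  ring

/-- The outcome of a step: the number of fresh vertices grows unless the step is degenerate. -/
def GoodStep [Fintype V] (k : ℕ) (μ ε : ℝ) (q : ℕ) (E : Finset (Finset V))
    (L₁ : Finset (Finset (Finset V))) (S : Finset (Finset V)) (L : Finset V) (d : ℕ) : Prop :=
  ∃ S' L' d', (S', L', d') ∈ succStates k μ ε q (S, L, d) ∧ ExpInv E L₁ S' L' ∧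
    L.card + (k * q + 1) * d + 1 ≤ L'.card + (k * q + 1) * d'

/-- A degenerate step. It covers at most k * q vertices, so it destroys at most that many fresh
ones, and the credit k * q + 1 for raising the counter outweighs the loss by one. -/
theorem goodStep_of_wt_lt [Fintype V]
    (hε : ∀ j i : ℕ, j ≤ k * q → i ≤ q → (j : ℝ) - μ * i < 0 → (j : ℝ) - μ * i ≤ -ε)
    (h : ExpInv E L₁ S L) (hQE : Q ⊆ E) (hu : ∀ e ∈ Q, e.card = k) (hq : Q.card ≤ q)
    (hlt : wt μ (S ∪ Q) < wt μ S) (d : ℕ) : GoodStep k μ ε q E L₁ S L d := by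
  classical
  have hcovQ : (cov Q).card ≤ k * q := (card_cov_le hu).trans (Nat.mul_le_mul_left k hq)
  have hnew : (Q \ S).Nonempty := by
    rw [Finset.sdiff_nonempty]
    intro hsub
    rw [Finset.union_eq_left.2 hsub] at hlt
    exact lt_irrefl _ hlt
  refine ⟨S ∪ Q, L \ cov Q, d + 1, ?_, h.union hQE, ?_⟩
  · refine Finset.mem_union_right _ (Finset.mem_image.2 ⟨Q, ?_, rfl⟩)
    rw [Finset.mem_filter]
    refine ⟨Finset.mem_univ _, hu, hq, Finset.inter_subset_right, hnew, ?_⟩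
    refine hε _ _ ((Finset.card_le_card Finset.sdiff_subset).trans hcovQ)
      ((Finset.card_le_card Finset.sdiff_subset).trans hq) ?_
    rw [wt_union_eq] at hlt
    linarith
  · have := Finset.le_card_sdiff (cov Q) L
    have h2 : (k * q + 1) * (d + 1) = (k * q + 1) * d + (k * q + 1) := by ring
    omega

/-- A regular step. The vertices in `Y` are new, so every explored edge at them comes from `Q`, and
freshness need only be checked inside `Q`. -/
theorem goodStep_of_wt_eq [Fintype V]
    (h : ExpInv E L₁ S L) (hQE : Q ⊆ E) (hu : ∀ e ∈ Q, e.card = k) (hq : Q.card ≤ q)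
    (hnew : (Q \ S).Nonempty) (heq : wt μ (S ∪ Q) = wt μ S) (hA : cov Q ∩ cov S ⊆ anchor S L)
    {Y : Finset V} (hY : Y ⊆ cov Q \ cov S) (hYne : Y.Nonempty)
    (hYfresh : ∀ x ∈ Y, ∃ P ∈ L₁, P ⊆ Q ∧ ∀ g ∈ Q, x ∈ g → g ∈ P)
    (hYindep : ∀ g ∈ Q, ∀ x ∈ Y, ∀ y ∈ Y ∪ (L \ cov Q), x ∈ g → y ∈ g → x = y)
    (hcard : (L ∩ cov Q).card < Y.card) (d : ℕ) :
    GoodStep k μ ε q E L₁ S L d := by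
  classical
  have hi := h.union hQE
  have hgQ : ∀ x ∈ Y, ∀ g ∈ S ∪ Q, x ∈ g → g ∈ Q := fun x hx g hg hxg => by
    rcases Finset.mem_union.1 hg with h1 | h1
    · exact absurd (subset_cov h1 hxg) (Finset.mem_sdiff.1 (hY hx)).2
    · exact h1
  have hdisj : Disjoint (L \ cov Q) Y := by
    rw [Finset.disjoint_left]
    intro x hx hxY
    exact (Finset.mem_sdiff.1 hx).2 (Finset.mem_sdiff.1 (hY hxY)).1
  refine ⟨S ∪ Q, (L \ cov Q) ∪ Y, d, ?_, ⟨hi.sub, hi.base, ?_, ?_⟩, ?_⟩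
  · refine Finset.mem_union_left _ (Finset.mem_image.2 ⟨(Q, Y), ?_, rfl⟩)
    rw [Finset.mem_filter]
    refine ⟨Finset.mem_univ _, ⟨hu, hq, hA, hnew, ?_⟩, hY, hYne⟩
    rw [wt_union_eq] at heq
    linarith
  · intro x hx
    rcases Finset.mem_union.1 hx with h1 | h1
    · exact hi.fresh x h1
    · obtain ⟨P, hP, hPQ, hall⟩ := hYfresh x h1
      obtain ⟨g, hg, hxg⟩ := mem_cov.1 (Finset.mem_sdiff.1 (hY h1)).1
      exact ⟨⟨g, Finset.mem_union_right _ hg, hxg⟩, P, hP,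
        hPQ.trans Finset.subset_union_right, fun g' hg' hxg' => hall g' (hgQ x h1 g' hg' hxg') hxg'⟩
  · intro g hg x hx y hy hxg hyg
    rcases Finset.mem_union.1 hx with h1 | h1
    · rcases Finset.mem_union.1 hy with h2 | h2
      · exact hi.indep g hg x h1 y h2 hxg hyg
      · exact (hYindep g (hgQ y h2 g hg hyg) y h2 x (Finset.mem_union_right _ h1) hyg hxg).symm
    · exact hYindep g (hgQ x h1 g hg hxg) x h1 y (by rwa [Finset.union_comm]) hxg hyg
  · rw [Finset.card_union_of_disjoint hdisj]
    have := Finset.card_sdiff_add_card_inter L (cov Q)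
    omega

/-- A step at the edge `e₀`, along a copy `F₂` of `H₂` that is not yet explored. -/
theorem goodStep_flower [Fintype V] (hc : IsCore L₁ L₂) (hμ : 0 < μ) (hμν : μ ≤ ν) (hν : ν < 1)
    {e₁ e₂ : ℕ} (h₁ : ∀ F ∈ L₁, IsPiece k μ ν F ∧ F.card = e₁)
    (h₂ : ∀ F ∈ L₂, IsPiece k ν ν F ∧ F.card = e₂) (hq : e₂ + e₂ * e₁ ≤ q)
    (hE : ∀ F ∈ L₁ ∪ L₂, F ⊆ E)
    (hε : ∀ j i : ℕ, j ≤ k * q → i ≤ q → (j : ℝ) - μ * i < 0 → (j : ℝ) - μ * i ≤ -ε)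
    (h : ExpInv E L₁ S L) {F₂ : Finset (Finset V)} (hF₂ : F₂ ∈ L₂) {e₀ : Finset V}
    (he₀ : e₀ ∈ F₂) (he₀S : e₀ ∈ S) (hF₂S : ¬ F₂ ⊆ S) (hA : e₀ ⊆ anchor S L) (d : ℕ) :
    GoodStep k μ ε q E L₁ S L d := by
  classical
  choose! P hPL hP using hc.right F₂ hF₂
  have hPsub : ∀ e ∈ F₂ \ S, IsPiece k μ ν (P e) ∧ P e ∩ F₂ = {e} := fun e he =>
    ⟨(h₁ _ (hPL e (Finset.mem_sdiff.1 he).1)).1, hP e (Finset.mem_sdiff.1 he).1⟩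
  have hflower := flower_wt (h₂ F₂ hF₂).1 hμ hμν hν he₀ he₀S hF₂S hPsub
  set Q := F₂ ∪ (F₂ \ S).biUnion P with hQ
  have hQE : Q ⊆ E := by
    refine Finset.union_subset (hE F₂ (Finset.mem_union_right _ hF₂))
      (Finset.biUnion_subset.2 fun e he => hE _ (Finset.mem_union_left _ ?_))
    exact hPL e (Finset.mem_sdiff.1 he).1
  have hu : ∀ e ∈ Q, e.card = k := by
    intro e he
    rcases Finset.mem_union.1 he with h1 | h1
    · exact (h₂ F₂ hF₂).1.uniform e h1
    · obtain ⟨a, ha, hea⟩ := Finset.mem_biUnion.1 h1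
      exact (hPsub a ha).1.uniform e hea
  have hQq : Q.card ≤ q := by
    refine le_trans ?_ hq
    refine (Finset.card_union_le _ _).trans (Nat.add_le_add (h₂ F₂ hF₂).2.le ?_)
    refine (Finset.card_biUnion_le_card_mul _ _ e₁ fun e he =>
      (h₁ _ (hPL e (Finset.mem_sdiff.1 he).1)).2.le).trans (Nat.mul_le_mul_right _ ?_)
    exact (Finset.card_le_card Finset.sdiff_subset).trans (h₂ F₂ hF₂).2.le
  rcases hflower with hlt | ⟨heq, hF₂cov, hreg⟩
  · exact goodStep_of_wt_lt hε h hQE hu hQq hlt d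
  have hmem : ∀ e ∈ F₂ \ S, e ∈ P e := fun e he =>
    Finset.mem_of_mem_inter_left (by rw [(hPsub e he).2]; exact Finset.mem_singleton_self e)
  have hnew : (Q \ S).Nonempty := by
    rw [Finset.sdiff_nonempty]
    exact fun hh => hF₂S (Finset.subset_union_left.trans hh)
  have hcovQ : cov Q ∩ cov S ⊆ e₀ := by
    intro x hx
    rw [Finset.mem_inter, hQ, cov_union, Finset.mem_union] at hx
    rw [← hF₂cov]
    rcases hx with ⟨h1 | h1, h2⟩
    · exact Finset.mem_inter.2 ⟨h1, h2⟩
    · obtain ⟨g, hg, hxg⟩ := mem_cov.1 h1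
      obtain ⟨e, he, hge⟩ := Finset.mem_biUnion.1 hg
      have : x ∈ cov (P e) ∩ (cov S ∪ cov F₂) :=
        Finset.mem_inter.2 ⟨subset_cov hge hxg, Finset.mem_union_left _ h2⟩
      rw [(hreg e he).1] at this
      exact Finset.mem_inter.2 ⟨subset_cov (Finset.mem_sdiff.1 he).1 this, h2⟩
  -- one fresh vertex in each petal
  have hex : ∀ e ∈ F₂ \ S, ∃ x ∈ cov (P e), x ∉ cov S ∪ cov F₂ := by
    intro e he
    by_contra! hcon
    have h1 := (hPsub e he).1.lt_cov
    rw [← Finset.inter_eq_left.2 (show cov (P e) ⊆ cov S ∪ cov F₂ from hcon), (hreg e he).1,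
      (h₂ F₂ hF₂).1.uniform e (Finset.mem_sdiff.1 he).1] at h1
    exact lt_irrefl _ h1
  have : Nonempty V :=
    ⟨(Finset.card_pos.1 (Nat.zero_lt_of_lt (h₂ F₂ hF₂).1.lt_cov)).choose⟩
  choose! x hxP hxn using hex
  have hxe : ∀ e ∈ F₂ \ S, ∀ e' ∈ F₂ \ S, x e ∈ cov (P e') → e = e' := by
    intro e he e' he' hmem'
    by_contra hne
    exact hxn e he ((hreg e he).2 e' he' hne (Finset.mem_inter.2 ⟨hxP e he, hmem'⟩))
  have hxedge : ∀ e ∈ F₂ \ S, ∀ g ∈ Q, x e ∈ g → g ∈ P e := by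
    intro e he g hg hxg
    rcases Finset.mem_union.1 hg with h1 | h1
    · exact absurd (Finset.mem_union_right _ (subset_cov h1 hxg)) (hxn e he)
    · obtain ⟨e', he', hge'⟩ := Finset.mem_biUnion.1 h1
      rw [hxe e he e' he' (subset_cov hge' hxg)]
      exact hge'
  have hinj : Set.InjOn x (F₂ \ S : Finset (Finset V)) := fun e he e' he' hee' =>
    hxe e he e' he' (hee' ▸ hxP e' he')
  have hcardY : ((F₂ \ S).image x).card = (F₂ \ S).card := Finset.card_image_of_injOn hinj
  -- The centre has at least three edges and at most one is explored, so there are at least two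
  -- petals and two new fresh vertices.
  have hFS1 : (F₂ ∩ S).card ≤ 1 := by
    refine card_le_one_of_cov_subset (k := k) (W := e₀)
      (fun g hg => (h₂ F₂ hF₂).1.uniform g (Finset.mem_of_mem_inter_left hg)) ?_
      ((h₂ F₂ hF₂).1.uniform e₀ he₀).le
    rw [← hF₂cov]
    exact cov_inter_subset F₂ S
  have hFS2 : 2 ≤ (F₂ \ S).card := by
    have h3 := (h₂ F₂ hF₂).1.two_lt_card (hμ.trans_le hμν) le_rfl hν
    have := Finset.card_sdiff_add_card_inter F₂ S
    omega
  refine goodStep_of_wt_eq h hQE hu hQq hnew heq (hcovQ.trans hA) (Y := (F₂ \ S).image x)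
    ?_ ?_ ?_ ?_ ?_ d
  · intro y hy
    obtain ⟨e, he, rfl⟩ := Finset.mem_image.1 hy
    refine Finset.mem_sdiff.2 ⟨?_, fun hh => hxn e he (Finset.mem_union_left _ hh)⟩
    rw [hQ, cov_union]
    exact Finset.mem_union_right _ (cov_mono (Finset.subset_biUnion_of_mem P he) (hxP e he))
  · rw [← Finset.card_pos]; omega
  · intro y hy
    obtain ⟨e, he, rfl⟩ := Finset.mem_image.1 hy
    exact ⟨P e, hPL e (Finset.mem_sdiff.1 he).1,
      (Finset.subset_biUnion_of_mem P he).trans Finset.subset_union_right, hxedge e he⟩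
  · intro g hg y hy z hz hyg hzg
    obtain ⟨e, he, rfl⟩ := Finset.mem_image.1 hy
    have hgP := hxedge e he g hg hyg
    rcases Finset.mem_union.1 hz with hz | hz
    · obtain ⟨e', he', rfl⟩ := Finset.mem_image.1 hz
      rw [hxe e' he' e he (subset_cov hgP hzg)]
    · exact absurd (subset_cov hg hzg) (Finset.mem_sdiff.1 hz).2
  · rw [hcardY]
    -- The fresh vertices lost all lie in the explored edge `e₀`, which contains at most one.
    refine lt_of_le_of_lt (Finset.card_le_one.2 ?_) (lt_of_lt_of_le one_lt_two hFS2)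
    have hin : ∀ a ∈ L ∩ cov Q, a ∈ L ∧ a ∈ e₀ := fun a ha => by
      rw [Finset.mem_inter] at ha
      obtain ⟨⟨g, hg, hag⟩, -⟩ := h.fresh a ha.1
      exact ⟨ha.1, hcovQ (Finset.mem_inter.2 ⟨ha.2, subset_cov hg hag⟩)⟩
    intro a ha b hb
    exact h.indep e₀ he₀S a (hin a ha).1 b (hin b hb).1 (hin a ha).2 (hin b hb).2

/-- The exploration goes on until there is no fresh vertex and everything is explored. -/
theorem goodStep_or_closed [Fintype V] (hc : IsCore L₁ L₂) (hμ : 0 < μ) (hμν : μ ≤ ν) (hν : ν < 1)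
    {e₁ e₂ : ℕ} (h₁ : ∀ F ∈ L₁, IsPiece k μ ν F ∧ F.card = e₁)
    (h₂ : ∀ F ∈ L₂, IsPiece k ν ν F ∧ F.card = e₂) (hq : e₂ + e₂ * e₁ ≤ q) (hq₁ : e₁ ≤ q)
    (hE : ∀ F ∈ L₁ ∪ L₂, F ⊆ E)
    (hε : ∀ j i : ℕ, j ≤ k * q → i ≤ q → (j : ℝ) - μ * i < 0 → (j : ℝ) - μ * i ≤ -ε)
    (h : ExpInv E L₁ S L) (d : ℕ) :
    (L = ∅ ∧ ∀ F ∈ L₁ ∪ L₂, F ⊆ S) ∨ GoodStep k μ ε q E L₁ S L d := by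
  rcases L.eq_empty_or_nonempty with rfl | ⟨x, hx⟩
  · by_cases hcl : ∀ F ∈ L₁ ∪ L₂, F ⊆ S ∨ Disjoint F S
    · exact Or.inl ⟨rfl, hc.closed S hcl h.base⟩
    right
    push Not at hcl
    obtain ⟨F, hF, hFS, hnd⟩ := hcl
    obtain ⟨e₀, he₀, he₀S⟩ := Finset.not_disjoint_iff.1 hnd
    rcases Finset.mem_union.1 hF with hF₁ | hF₂
    · have hp := (h₁ F hF₁).1
      have hne : (S ∩ F).Nonempty := ⟨e₀, Finset.mem_inter.2 ⟨he₀S, he₀⟩⟩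
      have hFq : F.card ≤ q := (h₁ F hF₁).2.le.trans hq₁
      rcases (hp.wt_union_le hμ hμν hne).lt_or_eq with hlt | heq
      · exact goodStep_of_wt_lt hε h (hE F hF) hp.uniform hFq hlt d
      -- Without a drop the overlap has only `k` vertices, so `F` has a vertex outside `S`, and it
      -- can serve as the fresh one.
      have hk : ¬ k < (cov S ∩ cov F).card := fun hk =>
        (hp.wt_union_lt hμ hne hFS (Or.inr hk)).ne heq
      obtain ⟨y, hyF, hyS⟩ : ∃ y ∈ cov F, y ∉ cov S := by
        by_contra! hcon
        rw [Finset.inter_eq_right.2 (show cov F ⊆ cov S from hcon)] at hk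
        exact hk hp.lt_cov
      refine goodStep_of_wt_eq h (hE F hF) hp.uniform hFq (Finset.sdiff_nonempty.2 hFS) heq ?_
        (Y := {y}) ?_ (Finset.singleton_nonempty y) ?_ ?_ ?_ d
      · rw [anchor_empty]; exact Finset.inter_subset_right
      · simpa using ⟨hyF, hyS⟩
      · exact fun z hz => ⟨F, hF₁, subset_rfl, fun g hg _ => hg⟩
      · intro g _ a ha b hb _ _
        simp only [Finset.empty_sdiff, Finset.union_empty, Finset.mem_singleton] at ha hb
        rw [ha, hb]
      · simp
    · exact goodStep_flower hc hμ hμν hν h₁ h₂ hq hE hε h hF₂ he₀ he₀S hFS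
        (by rw [anchor_empty]; exact subset_cov he₀S) d
  · right
    obtain ⟨⟨g, hg, hxg⟩, -⟩ := h.fresh x hx
    obtain ⟨hAS, y, hy, hyA⟩ := anchor_spec (S := S) (L := L) ⟨g, hg, x, hx, hxg⟩
    obtain ⟨-, P, hP, hPS, hall⟩ := h.fresh y hy
    obtain ⟨F₂, hF₂, hinter⟩ := hc.left P hP _ (hall _ hAS hyA)
    have hAF : anchor S L ∈ F₂ :=
      Finset.mem_of_mem_inter_right (by rw [hinter]; exact Finset.mem_singleton_self _)
    -- All explored edges at the fresh vertex `y` lie in `P`, and `F₂` meets `P` only in the anchor.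
    -- The second edge of `F₂` at `y` is therefore unexplored.
    refine goodStep_flower hc hμ hμν hν h₁ h₂ hq hE hε h hF₂ hAF hAS (fun hsub => ?_) subset_rfl d
    obtain ⟨g', hg', hne, hyg'⟩ := (h₂ F₂ hF₂).1.exists_ne_mem (hμ.trans_le hμν) le_rfl hν
      (subset_cov hAF hyA) hAF
    have : g' ∈ P ∩ F₂ := Finset.mem_inter.2 ⟨hall g' (hsub hg') hyg', hg'⟩
    rw [hinter, Finset.mem_singleton] at this
    exact hne this

theorem card_reach_le [Fintype V] {C : Finset (Finset (Finset V))} {e₁ : ℕ}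
    (hC : ∀ F ∈ C, (∀ e ∈ F, e.card = k) ∧ F.card = e₁) (t : ℕ) :
    ∀ σ ∈ reach k μ ε q C t, (∀ e ∈ σ.1, e.card = k) ∧ σ.1.card ≤ e₁ + t * q := by
  classical
  induction t with
  | zero =>
    intro σ hσ
    obtain ⟨F, hF, rfl⟩ := Finset.mem_image.1 hσ
    simpa using ⟨(hC F hF).1, (hC F hF).2.le⟩
  | succ t ih =>
    intro σ hσ
    obtain ⟨τ, hτ, hστ⟩ := Finset.mem_biUnion.1 hσ
    have key : ∃ Q : Finset (Finset V), (∀ e ∈ Q, e.card = k) ∧ Q.card ≤ q ∧ σ.1 = τ.1 ∪ Q := by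
      rcases Finset.mem_union.1 hστ with h | h
      · obtain ⟨c, hc, rfl⟩ := Finset.mem_image.1 h
        rw [Finset.mem_filter] at hc
        exact ⟨c.1, hc.2.1.uniform, hc.2.1.card_le, rfl⟩
      · obtain ⟨Q, hQ, rfl⟩ := Finset.mem_image.1 h
        rw [Finset.mem_filter] at hQ
        exact ⟨Q, hQ.2.uniform, hQ.2.card_le, rfl⟩
    obtain ⟨Q, hQu, hQq, hσQ⟩ := key
    rw [hσQ]
    refine ⟨fun e he => ?_, ?_⟩
    · rcases Finset.mem_union.1 he with h | h
      exacts [(ih τ hτ).1 e h, hQu e h]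
    · have h1 := Finset.card_union_le τ.1 Q
      have h2 := (ih τ hτ).2
      have h3 : (t + 1) * q = t * q + q := by ring
      omega

/-- If a core is present in `E`, then `E` contains the explored edges of a state after `T` steps or
of a state with many degenerate steps, or the core is small. -/
theorem exploration_outcome [Fintype V] (hc : IsCore L₁ L₂) (hμ : 0 < μ) (hμν : μ ≤ ν)
    (hν : ν < 1) {C : Finset (Finset (Finset V))} (hLC : L₁ ⊆ C) (hne : L₁.Nonempty)
    {e₁ e₂ : ℕ} (hC : ∀ F ∈ C, IsPiece k μ ν F ∧ F.card = e₁)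
    (h₂ : ∀ F ∈ L₂, IsPiece k ν ν F ∧ F.card = e₂) (hq : e₂ + e₂ * e₁ ≤ q) (hq₁ : e₁ ≤ q)
    (hE : ∀ F ∈ L₁ ∪ L₂, F ⊆ E)
    (hε : ∀ j i : ℕ, j ≤ k * q → i ≤ q → (j : ℝ) - μ * i < 0 → (j : ℝ) - μ * i ≤ -ε)
    (T D : ℕ) :
    (∃ σ ∈ reach k μ ε q C T, σ.1 ⊆ E) ∨
    (∃ t < T, ∃ σ ∈ reach k μ ε q C t, D ≤ σ.2.2 ∧ σ.1 ⊆ E) ∨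
    (∃ S ⊆ E, S.card ≤ e₁ + (k * q + 1) * D * q ∧ ∀ F ∈ L₁ ∪ L₂, F ⊆ S) := by
  classical
  have h₁ : ∀ F ∈ L₁, IsPiece k μ ν F ∧ F.card = e₁ := fun F hF => hC F (hLC hF)
  -- A closed state has no fresh vertex, so its number of steps is at most (k * q + 1) times its
  -- number of degenerate steps. Fewer than `D` of these bound its size.
  by_cases hcl : ∃ t < T, ∃ σ ∈ reach k μ ε q C t, σ.1 ⊆ E ∧ t ≤ (k * q + 1) * σ.2.2 ∧
      ∀ F ∈ L₁ ∪ L₂, F ⊆ σ.1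
  · right
    obtain ⟨t, htT, σ, hσ, hσE, ht, hall⟩ := hcl
    rcases Nat.lt_or_ge σ.2.2 D with hD | hD
    · right
      refine ⟨σ.1, hσE, ?_, hall⟩
      refine (card_reach_le (fun F hF => ⟨(hC F hF).1.uniform, (hC F hF).2⟩) t σ hσ).2.trans ?_
      exact Nat.add_le_add_left (Nat.mul_le_mul_right _
        (ht.trans (Nat.mul_le_mul_left _ hD.le))) _
    · exact Or.inl ⟨t, htT, σ, hσ, hD, hσE⟩
  left
  have key : ∀ t ≤ T, ∃ S L d, (S, L, d) ∈ reach k μ ε q C t ∧ ExpInv E L₁ S L ∧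
      t ≤ L.card + (k * q + 1) * d := by
    intro t
    induction t with
    | zero =>
      intro _
      obtain ⟨F, hF⟩ := hne
      refine ⟨F, ∅, 0, Finset.mem_image.2 ⟨F, hLC hF, rfl⟩,
        ⟨hE F (Finset.mem_union_left _ hF), ⟨F, hF, subset_rfl⟩, ?_, ?_⟩, Nat.zero_le _⟩ <;> simp
    | succ t ih =>
      intro htT
      obtain ⟨S, L, d, hmem, hinv, hcard⟩ := ih (by omega)
      rcases goodStep_or_closed hc hμ hμν hν h₁ h₂ hq hq₁ hE hε hinv d with
        ⟨rfl, hall⟩ | ⟨S', L', d', hmem', hinv', hcard'⟩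
      · exact absurd ⟨t, by omega, (S, ∅, d), hmem, hinv.sub, by simpa using hcard, hall⟩ hcl
      · exact ⟨S', L', d', Finset.mem_biUnion.2 ⟨_, hmem, hmem'⟩, hinv', by omega⟩
  obtain ⟨S, L, d, hmem, hinv, -⟩ := key T le_rfl
  exact ⟨_, hmem, hinv.sub⟩

end Exploration

end KGraph

/-! ### Counting the states: the weighted union bound -/

namespace KGraph

section Counting

theorem sum_pow_le_succ_pow (N q : ℕ) : ∑ i ∈ Finset.range (q + 1), N ^ i ≤ (N + 1) ^ q := by
  induction q with
  | zero => simp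
  | succ q ih =>
    rw [Finset.sum_range_succ, pow_succ (N + 1)]
    have h1 : N ^ q ≤ (N + 1) ^ q := Nat.pow_le_pow_left (Nat.le_succ N) q
    calc _ ≤ (N + 1) ^ q + N ^ q * N := Nat.add_le_add ih (pow_succ N q).le
      _ ≤ (N + 1) ^ q + (N + 1) ^ q * N := Nat.add_le_add_left (Nat.mul_le_mul_right N h1) _
      _ = (N + 1) ^ q * (N + 1) := by ring

theorem card_filter_powerset_card_le {α : Type*} [DecidableEq α] (s : Finset α) (q : ℕ) :
    (s.powerset.filter fun t => t.card ≤ q).card ≤ (s.card + 1) ^ q := by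
  have : (s.powerset.filter fun t => t.card ≤ q) ⊆
      (Finset.range (q + 1)).biUnion fun i => s.powersetCard i := by
    intro t ht
    rw [Finset.mem_filter, Finset.mem_powerset] at ht
    exact Finset.mem_biUnion.2 ⟨t.card, Finset.mem_range.2 (Nat.lt_succ_of_le ht.2),
      Finset.mem_powersetCard.2 ⟨ht.1, rfl⟩⟩
  refine (Finset.card_le_card this).trans (Finset.card_biUnion_le.trans ?_)
  refine le_trans (Finset.sum_le_sum fun i _ => ?_) (sum_pow_le_succ_pow s.card q)
  rw [Finset.card_powersetCard]
  exact Nat.choose_le_pow _ _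

/-- A bound for the number of sets of at most `q` edges that are spanned by at most `a + k * q`
given vertices. -/
def numSets (k q a : ℕ) : ℕ := ((a + k * q) ^ k + 1) ^ q

theorem numSets_mono {k q a b : ℕ} (h : a ≤ b) : numSets k q a ≤ numSets k q b := by
  unfold numSets; gcongr

variable {V : Type*} [DecidableEq V] [Fintype V] {k q : ℕ} {μ δ : ℝ}

open Classical in
-- With j new vertices and i new edges, p^i ≤ b * n^(-j - δ), since i ≥ 1 and b ≤ 1. The n^(-j)
-- cancels the choice of the new vertices, and `numSets` bounds the edge sets on these together with
-- `A`.
theorem sum_grow_le {n : ℕ} (hn : Fintype.card V = n) (hn1 : 1 ≤ n) {b p : ℝ}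
    (hb : 0 ≤ b) (hb1 : b ≤ 1) (hp : 0 ≤ p) (hpb : p ≤ b * (n : ℝ) ^ (-μ))
    (S : Finset (Finset V)) (A : Finset V) :
    ∑ Q ∈ Finset.univ.filter (fun Q => Grow k μ δ q S A Q), p ^ (Q \ S).card ≤
      (k * q + 1 : ℕ) * numSets k q A.card * b * (n : ℝ) ^ (-δ) := by
  have hn0 : (0 : ℝ) < n := by exact_mod_cast hn1
  have hn1' : (1 : ℝ) ≤ n := by exact_mod_cast hn1
  have hterm : ∀ Q ∈ Finset.univ.filter (fun Q => Grow k μ δ q S A Q),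
      p ^ (Q \ S).card ≤ b * (n : ℝ) ^ (-δ) * ((n : ℝ) ^ (cov Q \ cov S).card)⁻¹ := by
    intro Q hQ
    have hg := (Finset.mem_filter.1 hQ).2
    have hi : 1 ≤ (Q \ S).card := Finset.card_pos.2 hg.new
    calc p ^ (Q \ S).card ≤ (b * (n : ℝ) ^ (-μ)) ^ (Q \ S).card := pow_le_pow_left₀ hp hpb _
      _ = b ^ (Q \ S).card * (n : ℝ) ^ (-μ * (Q \ S).card) := by
        rw [mul_pow, Real.rpow_mul_natCast hn0.le]
      _ ≤ b * (n : ℝ) ^ (-δ + -((cov Q \ cov S).card : ℝ)) := by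
        refine mul_le_mul (pow_le_of_le_one hb hb1 (by omega)) ?_ (by positivity) hb
        exact Real.rpow_le_rpow_of_exponent_le hn1' (by linarith [hg.wt_le])
      _ = _ := by
        rw [Real.rpow_add hn0, Real.rpow_neg hn0.le (((cov Q \ cov S).card : ℕ) : ℝ),
          Real.rpow_natCast, mul_assoc]
  refine (Finset.sum_le_sum hterm).trans ?_
  rw [← Finset.mul_sum]
  have hmaps : ∀ Q ∈ Finset.univ.filter (fun Q => Grow k μ δ q S A Q),
      cov Q \ cov S ∈ Finset.univ.filter fun X : Finset V => X.card < k * q + 1 := by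
    intro Q hQ
    have hg := (Finset.mem_filter.1 hQ).2
    rw [Finset.mem_filter]
    refine ⟨Finset.mem_univ _, Nat.lt_succ_of_le ?_⟩
    exact (Finset.card_le_card Finset.sdiff_subset).trans
      ((card_cov_le hg.uniform).trans (Nat.mul_le_mul_left k hg.card_le))
  rw [← Finset.sum_fiberwise_of_maps_to hmaps]
  have hfib : ∀ X ∈ Finset.univ.filter (fun X : Finset V => X.card < k * q + 1),
      ∑ Q ∈ (Finset.univ.filter (fun Q => Grow k μ δ q S A Q)).filter
        (fun Q => cov Q \ cov S = X), ((n : ℝ) ^ (cov Q \ cov S).card)⁻¹ ≤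
      numSets k q A.card * ((n : ℝ) ^ X.card)⁻¹ := by
    intro X hX
    rw [Finset.sum_congr rfl (g := fun _ => ((n : ℝ) ^ X.card)⁻¹) (fun Q hQ => by
      rw [(Finset.mem_filter.1 hQ).2]), Finset.sum_const, nsmul_eq_mul]
    refine mul_le_mul_of_nonneg_right ?_ (by positivity)
    norm_cast
    have hsub : (Finset.univ.filter (fun Q => Grow k μ δ q S A Q)).filter
        (fun Q => cov Q \ cov S = X) ⊆
        (((A ∪ X).powersetCard k).powerset.filter fun t => t.card ≤ q) := by
      intro Q hQ
      rw [Finset.mem_filter, Finset.mem_filter] at hQ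
      obtain ⟨⟨-, hg⟩, rfl⟩ := hQ
      rw [Finset.mem_filter, Finset.mem_powerset]
      refine ⟨fun e he => Finset.mem_powersetCard.2 ⟨fun x hx => ?_, hg.uniform e he⟩, hg.card_le⟩
      have hxQ := subset_cov he hx
      by_cases hxS : x ∈ cov S
      · exact Finset.mem_union_left _ (hg.inter (Finset.mem_inter.2 ⟨hxQ, hxS⟩))
      · exact Finset.mem_union_right _ (Finset.mem_sdiff.2 ⟨hxQ, hxS⟩)
    refine (Finset.card_le_card hsub).trans ((card_filter_powerset_card_le _ _).trans ?_)
    unfold numSets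
    refine Nat.pow_le_pow_left (Nat.add_le_add_right ?_ 1) q
    rw [Finset.card_powersetCard]
    refine (Nat.choose_le_pow _ _).trans (Nat.pow_le_pow_left ?_ k)
    refine (Finset.card_union_le _ _).trans (Nat.add_le_add_left ?_ _)
    exact Nat.lt_succ_iff.1 (Finset.mem_filter.1 hX).2
  have hsumX : ∑ X ∈ Finset.univ.filter (fun X : Finset V => X.card < k * q + 1),
      ((n : ℝ) ^ X.card)⁻¹ ≤ (k * q + 1 : ℕ) := by
    have hmaps' : ∀ X ∈ Finset.univ.filter (fun X : Finset V => X.card < k * q + 1),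
        X.card ∈ Finset.range (k * q + 1) := fun X hX =>
      Finset.mem_range.2 (Finset.mem_filter.1 hX).2
    rw [← Finset.sum_fiberwise_of_maps_to hmaps']
    calc _ ≤ ∑ j ∈ Finset.range (k * q + 1), (1 : ℝ) := by
          refine Finset.sum_le_sum fun j _ => ?_
          rw [Finset.sum_congr rfl (g := fun _ => ((n : ℝ) ^ j)⁻¹) (fun X hX => by
            rw [(Finset.mem_filter.1 hX).2]), Finset.sum_const, nsmul_eq_mul]
          rw [mul_inv_le_iff₀ (by positivity), one_mul]
          have hsub : (Finset.univ.filter (fun X : Finset V => X.card < k * q + 1)).filter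
              (fun X => X.card = j) ⊆ (Finset.univ : Finset V).powersetCard j := fun X hX =>
            Finset.mem_powersetCard.2 ⟨Finset.subset_univ _, (Finset.mem_filter.1 hX).2⟩
          have := (Finset.card_le_card hsub).trans_eq (Finset.card_powersetCard _ _)
          rw [Finset.card_univ, hn] at this
          exact_mod_cast this.trans (Nat.choose_le_pow _ _)
      _ = _ := by simp
  calc b * (n : ℝ) ^ (-δ) * _ ≤ b * (n : ℝ) ^ (-δ) *
        ∑ X ∈ Finset.univ.filter (fun X : Finset V => X.card < k * q + 1),
          (numSets k q A.card * ((n : ℝ) ^ X.card)⁻¹) :=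
        mul_le_mul_of_nonneg_left (Finset.sum_le_sum hfib) (by positivity)
    _ ≤ b * (n : ℝ) ^ (-δ) * (numSets k q A.card * (k * q + 1 : ℕ)) := by
        rw [← Finset.mul_sum]
        exact mul_le_mul_of_nonneg_left (mul_le_mul_of_nonneg_left hsumX (by positivity))
          (by positivity)
    _ = _ := by ring

/-- The weight of a state in the union bound. -/
noncomputable def expWeight (p N M : ℝ) (σ : ExpState V) : ℝ :=
  p ^ σ.1.card * N ^ σ.2.2 * if σ.2.1 = ∅ then M else 1

theorem sum_image_le_sum {ι κ : Type*} [DecidableEq κ] (s : Finset ι) (g : ι → κ) (f : κ → ℝ)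
    (hf : ∀ x, 0 ≤ f x) : ∑ y ∈ s.image g, f y ≤ ∑ x ∈ s, f (g x) := by
  rw [← Finset.sum_fiberwise_of_maps_to (fun x hx => Finset.mem_image_of_mem g hx)]
  refine Finset.sum_le_sum fun y hy => ?_
  obtain ⟨x, hx, rfl⟩ := Finset.mem_image.1 hy
  exact Finset.single_le_sum (f := fun x => f (g x)) (fun i _ => hf _)
    (Finset.mem_filter.2 ⟨hx, rfl⟩)

theorem sum_biUnion_le_sum {ι κ : Type*} [DecidableEq κ] (s : Finset ι) (t : ι → Finset κ)
    (f : κ → ℝ) (hf : ∀ x, 0 ≤ f x) :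
    ∑ y ∈ s.biUnion t, f y ≤ ∑ x ∈ s, ∑ y ∈ t x, f y := by
  classical
  induction s using Finset.induction_on with
  | empty => simp
  | insert a s ha ih =>
    rw [Finset.biUnion_insert, Finset.sum_insert ha]
    have := Finset.sum_union_inter (s₁ := t a) (s₂ := s.biUnion t) (f := f)
    have h2 : 0 ≤ ∑ y ∈ t a ∩ s.biUnion t, f y := Finset.sum_nonneg fun _ _ => hf _
    linarith

/-- The potential `expWeight` halves at each step. The factor `M` on states without fresh vertices
pays for a freely placed regular step, after which a fresh vertex exists. Degenerate steps bring
n^(-ε), which pays for the free placement, for `N` and for a possible new `M`. -/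
theorem sum_succStates_le {n : ℕ} (hn : Fintype.card V = n) (hn1 : 1 ≤ n)
    {ε b p N M : ℝ} (hb : 0 ≤ b) (hb1 : b ≤ 1) (hp : 0 ≤ p) (hpb : p ≤ b * (n : ℝ) ^ (-μ))
    (hN : 1 ≤ N) (hM : 1 ≤ M) {s : ℕ}
    (hreg : (2 : ℝ) ^ (k * q) * ((k * q + 1 : ℕ) * numSets k q k * b) ≤ 1 / 4)
    (hfree : (2 : ℝ) ^ (k * q) * ((k * q + 1 : ℕ) * numSets k q s * b) ≤ M / 4)
    (hdeg : N * M * ((k * q + 1 : ℕ) * numSets k q s * b * (n : ℝ) ^ (-ε)) ≤ 1 / 4)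
    (σ : ExpState V) (hσ : ∀ e ∈ σ.1, e.card = k) (hs : (cov σ.1).card ≤ s) :
    ∑ τ ∈ succStates k μ ε q σ, expWeight p N M τ ≤ expWeight p N M σ / 2 := by
  classical
  obtain ⟨S, L, d⟩ := σ
  have hN0 : 0 ≤ N := zero_le_one.trans hN
  have hM0 : 0 ≤ M := zero_le_one.trans hM
  have hw0 : ∀ τ : ExpState V, 0 ≤ expWeight p N M τ := by
    intro τ
    unfold expWeight
    split_ifs <;> positivity
  set m : ℝ := if L = ∅ then M else 1 with hm
  have hm1 : 1 ≤ m := by rw [hm]; split_ifs <;> linarith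
  have hw : expWeight p N M (S, L, d) = p ^ S.card * N ^ d * m := by
    simp [expWeight, hm]
  set a := (anchor S L).card with ha
  have hnumA : (2 : ℝ) ^ (k * q) * ((k * q + 1 : ℕ) * numSets k q a * b) ≤ m / 4 := by
    by_cases hL : L = ∅
    · refine le_trans ?_ (hfree.trans_eq (by simp [hm, hL]))
      have : a ≤ s := by rw [ha, hL, anchor_empty]; exact hs
      have := numSets_mono (k := k) (q := q) this
      gcongr
    · refine le_trans ?_ (hreg.trans_eq (by simp [hm, hL]))
      have := numSets_mono (k := k) (q := q) (card_anchor_le (L := L) hσ hL)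
      gcongr
  have hnumS : N * M * ((k * q + 1 : ℕ) * numSets k q (cov S).card * b * (n : ℝ) ^ (-ε)) ≤
      1 / 4 := by
    refine le_trans ?_ hdeg
    have := numSets_mono (k := k) (q := q) hs
    gcongr
  have hX0 : 0 ≤ p ^ S.card * N ^ d := by positivity
  -- non-degenerate steps
  have h1 : ∑ τ ∈ (Finset.univ.filter fun c : Finset (Finset V) × Finset V =>
      Grow k μ 0 q S (anchor S L) c.1 ∧ c.2 ⊆ cov c.1 \ cov S ∧ c.2.Nonempty).image
      (fun c => (S ∪ c.1, (L \ cov c.1) ∪ c.2, d)), expWeight p N M τ ≤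
      p ^ S.card * N ^ d * (m / 4) := by
    refine (sum_image_le_sum _ _ _ hw0).trans ?_
    have hterm : ∀ c ∈ Finset.univ.filter (fun c : Finset (Finset V) × Finset V =>
        Grow k μ 0 q S (anchor S L) c.1 ∧ c.2 ⊆ cov c.1 \ cov S ∧ c.2.Nonempty),
        expWeight p N M (S ∪ c.1, (L \ cov c.1) ∪ c.2, d) =
          p ^ S.card * N ^ d * p ^ (c.1 \ S).card := by
      intro c hc
      obtain ⟨-, -, -, hne⟩ := Finset.mem_filter.1 hc
      -- The new state has a fresh vertex, so it does not carry the factor `M`.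
      have : (L \ cov c.1) ∪ c.2 ≠ ∅ := (hne.mono Finset.subset_union_right).ne_empty
      simp only [expWeight, if_neg this, card_union_eq_add_card_sdiff, pow_add]
      ring
    rw [Finset.sum_congr rfl hterm, ← Finset.mul_sum]
    refine mul_le_mul_of_nonneg_left ?_ hX0
    have hmaps : ∀ c ∈ Finset.univ.filter (fun c : Finset (Finset V) × Finset V =>
        Grow k μ 0 q S (anchor S L) c.1 ∧ c.2 ⊆ cov c.1 \ cov S ∧ c.2.Nonempty),
        c.1 ∈ Finset.univ.filter fun Q => Grow k μ 0 q S (anchor S L) Q := by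
      intro c hc
      exact Finset.mem_filter.2 ⟨Finset.mem_univ _, (Finset.mem_filter.1 hc).2.1⟩
    rw [← Finset.sum_fiberwise_of_maps_to hmaps]
    have hfib : ∀ Q ∈ Finset.univ.filter (fun Q => Grow k μ 0 q S (anchor S L) Q),
        ∑ c ∈ (Finset.univ.filter (fun c : Finset (Finset V) × Finset V =>
          Grow k μ 0 q S (anchor S L) c.1 ∧ c.2 ⊆ cov c.1 \ cov S ∧ c.2.Nonempty)).filter
          (fun c => c.1 = Q), p ^ (c.1 \ S).card ≤ (2 : ℝ) ^ (k * q) * p ^ (Q \ S).card := by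
      intro Q hQ
      have hg := (Finset.mem_filter.1 hQ).2
      rw [Finset.sum_congr rfl (g := fun _ => p ^ (Q \ S).card) (fun c hc => by
        rw [(Finset.mem_filter.1 hc).2]), Finset.sum_const, nsmul_eq_mul]
      refine mul_le_mul_of_nonneg_right ?_ (by positivity)
      have hsub : (Finset.univ.filter (fun c : Finset (Finset V) × Finset V =>
          Grow k μ 0 q S (anchor S L) c.1 ∧ c.2 ⊆ cov c.1 \ cov S ∧ c.2.Nonempty)).filter
          (fun c => c.1 = Q) ⊆ (cov Q).powerset.image fun Y => (Q, Y) := by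
        intro c hc
        rw [Finset.mem_filter, Finset.mem_filter] at hc
        obtain ⟨⟨-, -, hY, -⟩, rfl⟩ := hc
        exact Finset.mem_image.2 ⟨c.2, Finset.mem_powerset.2 (hY.trans Finset.sdiff_subset), rfl⟩
      have h3 := (Finset.card_le_card hsub).trans Finset.card_image_le
      rw [Finset.card_powerset] at h3
      have h4 : (cov Q).card ≤ k * q :=
        (card_cov_le hg.uniform).trans (Nat.mul_le_mul_left k hg.card_le)
      exact_mod_cast h3.trans (Nat.pow_le_pow_right two_pos h4)
    refine (Finset.sum_le_sum hfib).trans ?_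
    rw [← Finset.mul_sum]
    have h5 := sum_grow_le (q := q) (k := k) (δ := 0) hn hn1 hb hb1 hp hpb S (anchor S L)
    rw [neg_zero, Real.rpow_zero, mul_one] at h5
    exact (mul_le_mul_of_nonneg_left h5 (by positivity)).trans hnumA
  -- degenerate steps
  have h2 : ∑ τ ∈ (Finset.univ.filter fun Q : Finset (Finset V) =>
      Grow k μ ε q S (cov S) Q).image (fun Q => (S ∪ Q, L \ cov Q, d + 1)), expWeight p N M τ ≤
      p ^ S.card * N ^ d * (1 / 4) := by
    refine (sum_image_le_sum _ _ _ hw0).trans ?_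
    have hterm : ∀ Q ∈ Finset.univ.filter (fun Q : Finset (Finset V) => Grow k μ ε q S (cov S) Q),
        expWeight p N M (S ∪ Q, L \ cov Q, d + 1) ≤
          p ^ S.card * N ^ d * (N * M * p ^ (Q \ S).card) := by
      intro Q _
      have hle : (if L \ cov Q = ∅ then M else 1) ≤ M := by split_ifs <;> linarith
      simp only [expWeight, card_union_eq_add_card_sdiff, pow_add, pow_one]
      calc p ^ S.card * p ^ (Q \ S).card * (N ^ d * N) * (if L \ cov Q = ∅ then M else 1)
          ≤ p ^ S.card * p ^ (Q \ S).card * (N ^ d * N) * M :=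
            mul_le_mul_of_nonneg_left hle (by positivity)
        _ = _ := by ring
    refine (Finset.sum_le_sum hterm).trans ?_
    rw [← Finset.mul_sum, ← Finset.mul_sum]
    refine mul_le_mul_of_nonneg_left ?_ hX0
    exact (mul_le_mul_of_nonneg_left (sum_grow_le hn hn1 hb hb1 hp hpb S (cov S))
      (by positivity)).trans hnumS
  have h3 := Finset.sum_union_inter (f := expWeight p N M) (s₁ :=
    (Finset.univ.filter fun c : Finset (Finset V) × Finset V =>
      Grow k μ 0 q S (anchor S L) c.1 ∧ c.2 ⊆ cov c.1 \ cov S ∧ c.2.Nonempty).image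
      (fun c => (S ∪ c.1, (L \ cov c.1) ∪ c.2, d))) (s₂ :=
    (Finset.univ.filter fun Q : Finset (Finset V) =>
      Grow k μ ε q S (cov S) Q).image (fun Q => (S ∪ Q, L \ cov Q, d + 1)))
  have h4 : ∑ τ ∈ succStates k μ ε q (S, L, d), expWeight p N M τ ≤
      p ^ S.card * N ^ d * (m / 4) + p ^ S.card * N ^ d * (1 / 4) := by
    refine le_trans ?_ (add_le_add h1 h2)
    rw [← h3]
    exact le_add_of_nonneg_right (Finset.sum_nonneg fun _ _ => hw0 _)
  rw [hw]
  nlinarith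

theorem sum_reach_le {n : ℕ} (hn : Fintype.card V = n) (hn1 : 1 ≤ n)
    {ε b p N M : ℝ} (hb : 0 ≤ b) (hb1 : b ≤ 1) (hp : 0 ≤ p) (hp1 : p ≤ 1)
    (hpb : p ≤ b * (n : ℝ) ^ (-μ)) (hN : 1 ≤ N) (hM : 1 ≤ M) {e₁ T : ℕ}
    {C : Finset (Finset (Finset V))} (hC : ∀ F ∈ C, (∀ e ∈ F, e.card = k) ∧ F.card = e₁)
    (hreg : (2 : ℝ) ^ (k * q) * ((k * q + 1 : ℕ) * numSets k q k * b) ≤ 1 / 4)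
    (hfree : (2 : ℝ) ^ (k * q) * ((k * q + 1 : ℕ) * numSets k q (k * (e₁ + T * q)) * b) ≤ M / 4)
    (hdeg : N * M * ((k * q + 1 : ℕ) * numSets k q (k * (e₁ + T * q)) * b * (n : ℝ) ^ (-ε)) ≤
      1 / 4) (t : ℕ) (ht : t ≤ T) :
    ∑ σ ∈ reach k μ ε q C t, expWeight p N M σ ≤ (1 / 2) ^ t * (C.card * M) := by
  classical
  have hw0 : ∀ τ : ExpState V, 0 ≤ expWeight p N M τ := by
    intro τ
    unfold expWeight
    split_ifs <;> positivity
  induction t with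
  | zero =>
    rw [pow_zero, one_mul]
    refine (sum_image_le_sum _ _ _ hw0).trans ?_
    rw [← nsmul_eq_mul]
    refine Finset.sum_le_card_nsmul _ _ _ fun F _ => ?_
    simp only [expWeight, pow_zero, mul_one, if_true]
    exact mul_le_of_le_one_left (by linarith) (pow_le_one₀ hp hp1)
  | succ t ih =>
    refine (sum_biUnion_le_sum _ _ _ hw0).trans ?_
    have hstep : ∀ σ ∈ reach k μ ε q C t, ∑ τ ∈ succStates k μ ε q σ, expWeight p N M τ ≤
        expWeight p N M σ / 2 := by
      intro σ hσ
      obtain ⟨hu, hcard⟩ := card_reach_le hC t σ hσ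
      refine sum_succStates_le hn hn1 hb hb1 hp hpb hN hM hreg hfree hdeg σ hu ?_
      refine (card_cov_le hu).trans (Nat.mul_le_mul_left k (hcard.trans ?_))
      exact Nat.add_le_add_left (Nat.mul_le_mul_right q (by omega)) _
    refine (Finset.sum_le_sum hstep).trans ?_
    rw [← Finset.sum_div, pow_succ]
    have := ih (by omega)
    linarith

end Counting

end KGraph

/-! ### Asymptotic estimates -/

namespace KGraph

section Asymptotics

theorem eventually_log_pow_le (Z : ℝ) (m : ℕ) {c : ℝ} (hc : 0 < c) :
    ∀ᶠ n : ℕ in atTop, Z * ((Nat.log 2 n + 1 : ℕ) : ℝ) ^ m ≤ (n : ℝ) ^ c := by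
  have h1 := (isLittleO_log_rpow_rpow_atTop (m : ℝ) hc).bound
    (show (0 : ℝ) < 1 / ((|Z| + 1) * 3 ^ m) by positivity)
  have h2 := (tendsto_natCast_atTop_atTop (R := ℝ)).eventually h1
  filter_upwards [h2, eventually_ge_atTop 3] with n hn hn3
  have hn3' : (3 : ℝ) ≤ n := by exact_mod_cast hn3
  have hlog1 : 1 ≤ Real.log n := by
    rw [Real.le_log_iff_exp_le (by linarith)]
    linarith [Real.exp_one_lt_d9]
  have hlog0 : 0 ≤ Real.log n := by linarith
  have hle : ((Nat.log 2 n + 1 : ℕ) : ℝ) ≤ 3 * Real.log n := by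
    have h3 := Real.natLog_le_logb n 2
    rw [Real.logb, Nat.cast_ofNat] at h3
    have h4 : Real.log n / Real.log 2 ≤ 2 * Real.log n := by
      rw [div_le_iff₀ (Real.log_pos one_lt_two)]
      nlinarith [Real.log_two_gt_d9]
    push_cast
    linarith
  rw [Real.rpow_natCast, Real.norm_of_nonneg (by positivity),
    Real.norm_of_nonneg (by positivity)] at hn
  calc Z * ((Nat.log 2 n + 1 : ℕ) : ℝ) ^ m
      ≤ (|Z| + 1) * (3 * Real.log n) ^ m := by
        refine mul_le_mul (by linarith [le_abs_self Z]) (pow_le_pow_left₀ (by positivity) hle m)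
          (by positivity) (by positivity)
    _ = (|Z| + 1) * 3 ^ m * Real.log n ^ m := by rw [mul_pow]; ring
    _ ≤ (|Z| + 1) * 3 ^ m * (1 / ((|Z| + 1) * 3 ^ m) * (n : ℝ) ^ c) :=
        mul_le_mul_of_nonneg_left hn (by positivity)
    _ = (n : ℝ) ^ c := by field_simp

/-- After O(log n) steps the explored part has O(log n) vertices, so the number of ways to attach a
step is polylogarithmic. -/
theorem eventually_numSets_le (k q e a : ℕ) {Z : ℝ} (hZ : 0 ≤ Z) {c : ℝ} (hc : 0 < c) :
    ∀ᶠ n : ℕ in atTop,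
      Z * numSets k q (k * (e + a * (Nat.log 2 n + 1) * q)) ≤ (n : ℝ) ^ c := by
  filter_upwards [eventually_log_pow_le
    (Z * (((k * (e + a * q) + k * q) ^ k + 1) ^ q : ℕ)) (k * q) hc] with n hn
  refine le_trans ?_ hn
  rw [mul_assoc Z]
  refine mul_le_mul_of_nonneg_left ?_ hZ
  norm_cast
  set l := Nat.log 2 n + 1 with hl
  have hl1 : 1 ≤ l := by omega
  rw [pow_mul, ← mul_pow]
  refine Nat.pow_le_pow_left ?_ q
  have h1 : k * (e + a * l * q) + k * q ≤ (k * (e + a * q) + k * q) * l := by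
    have h2 : k * e ≤ k * e * l := Nat.le_mul_of_pos_right _ hl1
    have h3 : k * q ≤ k * q * l := Nat.le_mul_of_pos_right _ hl1
    nlinarith
  calc (k * (e + a * l * q) + k * q) ^ k + 1
      ≤ ((k * (e + a * q) + k * q) * l) ^ k + l ^ k :=
        Nat.add_le_add (Nat.pow_le_pow_left h1 k) (Nat.one_le_pow _ _ hl1)
    _ = ((k * (e + a * q) + k * q) ^ k + 1) * l ^ k := by rw [mul_pow]; ring

/-- Only finitely many values occur, so the negative ones are bounded away from 0. The value 1 is
inserted to make the minimum exist and to cap ε. -/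
theorem exists_weight_gap (μ : ℝ) (J I : ℕ) : ∃ ε : ℝ, 0 < ε ∧ ε ≤ 1 ∧
    ∀ j i : ℕ, j ≤ J → i ≤ I → (j : ℝ) - μ * i < 0 → (j : ℝ) - μ * i ≤ -ε := by
  classical
  set s := ((Finset.range (J + 1) ×ˢ Finset.range (I + 1)).filter
    fun x : ℕ × ℕ => (x.1 : ℝ) - μ * x.2 < 0).image fun x => μ * x.2 - (x.1 : ℝ) with hs
  have hne : (insert 1 s).Nonempty := Finset.insert_nonempty _ _
  refine ⟨(insert 1 s).min' hne, ?_, Finset.min'_le _ _ (Finset.mem_insert_self _ _), ?_⟩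
  · rw [Finset.lt_min'_iff]
    intro y hy
    rcases Finset.mem_insert.1 hy with rfl | hy
    · exact one_pos
    · obtain ⟨x, hx, rfl⟩ := Finset.mem_image.1 hy
      have := (Finset.mem_filter.1 hx).2
      linarith
  · intro j i hj hi hlt
    have : (insert 1 s).min' hne ≤ μ * i - j := by
      refine Finset.min'_le _ _ (Finset.mem_insert_of_mem (Finset.mem_image.2 ⟨(j, i), ?_, rfl⟩))
      rw [Finset.mem_filter, Finset.mem_product, Finset.mem_range, Finset.mem_range]
      exact ⟨⟨by simp only; omega, by simp only; omega⟩, hlt⟩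
    linarith

end Asymptotics

/-! ### From the union bound to the random k-graph -/

section Probability

/-- Expand the product of p + (1 - p) over the elements outside `T` and p + 0 over those in `T`. -/
theorem sum_superset_weight {α : Type*} [Fintype α] [DecidableEq α] (T : Finset α) (p : ℝ) :
    ∑ E : Finset α, (if T ⊆ E then p ^ E.card * (1 - p) ^ Eᶜ.card else 0) = p ^ T.card := by
  have h := Finset.prod_add (fun _ : α => p) (fun i => if i ∈ T then 0 else 1 - p) Finset.univ
  rw [Finset.powerset_univ] at h
  have h1 : ∏ i : α, (p + if i ∈ T then 0 else 1 - p) = p ^ T.card := by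
    rw [← Finset.prod_const, ← Finset.prod_subset (Finset.subset_univ T)]
    · exact Finset.prod_congr rfl fun i hi => by simp [hi]
    · exact fun i _ hi => by simp [hi]
  rw [← h1, h]
  refine Finset.sum_congr rfl fun E _ => ?_
  rw [Finset.prod_const, ← Finset.compl_eq_univ_sdiff]
  by_cases hT : T ⊆ E
  · rw [if_pos hT, Finset.prod_congr rfl (g := fun _ => 1 - p), Finset.prod_const]
    intro i hi
    rw [if_neg fun hiT => (Finset.mem_compl.1 hi) (hT hiT)]
  · rw [if_neg hT]
    obtain ⟨i, hiT, hiE⟩ := Finset.not_subset.1 hT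
    rw [Finset.prod_eq_zero (Finset.mem_compl.2 hiE) (by simp [hiT]), mul_zero]

theorem binomialProb_le_sum {k n : ℕ} {p : ℝ} (hp0 : 0 ≤ p) (hp1 : p ≤ 1)
    {P : KGraph.{0} k → Prop} (I : Finset (Finset (Finset (Fin n))))
    (h : ∀ E, P (onFin k n E) → ∃ g ∈ I, g ⊆ E.map (Function.Embedding.subtype _)) :
    binomialProb k n p P ≤ ∑ g ∈ I, p ^ g.card := by
  classical
  have hw : ∀ E : Finset {e : Finset (Fin n) // e.card = k},
      0 ≤ p ^ E.card * (1 - p) ^ Eᶜ.card := fun E => by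
    have : 0 ≤ 1 - p := by linarith
    positivity
  have h1 : binomialProb k n p P ≤
      ∑ E : Finset {e : Finset (Fin n) // e.card = k}, ∑ g ∈ I,
        if g ⊆ E.map (Function.Embedding.subtype _) then p ^ E.card * (1 - p) ^ Eᶜ.card else 0 := by
    unfold binomialProb
    refine Finset.sum_le_sum fun E _ => ?_
    have hnn : ∀ g ∈ I, 0 ≤ if g ⊆ E.map (Function.Embedding.subtype _) then
        p ^ E.card * (1 - p) ^ Eᶜ.card else 0 := fun g _ => by
      split_ifs
      exacts [hw E, le_rfl]
    split_ifs with hP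
    · obtain ⟨g, hg, hgE⟩ := h E hP
      refine le_trans (le_of_eq ?_) (Finset.single_le_sum hnn hg)
      simp only [if_pos hgE]
    · exact Finset.sum_nonneg hnn
  refine h1.trans ?_
  rw [Finset.sum_comm]
  refine Finset.sum_le_sum fun g _ => ?_
  by_cases hu : ∀ e ∈ g, e.card = k
  · have hg : (g.subtype fun e => e.card = k).map (Function.Embedding.subtype _) = g :=
      Finset.subtype_map_of_mem hu
    have hcard : (g.subtype fun e => e.card = k).card = g.card := by
      conv_rhs => rw [← hg]
      rw [Finset.card_map]
    rw [← hcard, ← sum_superset_weight]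
    refine Finset.sum_le_sum fun E _ => le_of_eq ?_
    have : g ⊆ E.map (Function.Embedding.subtype _) ↔ (g.subtype fun e => e.card = k) ⊆ E := by
      conv_lhs => rw [← hg]
      exact Finset.map_subset_map
    simp only [this]
  · refine le_trans (Finset.sum_nonpos fun E _ => ?_) (pow_nonneg hp0 _)
    rw [if_neg]
    intro hgE
    apply hu
    intro e he
    obtain ⟨x, -, rfl⟩ := Finset.mem_map.1 (hgE he)
    exact x.2

theorem sum_union_le {κ : Type*} [DecidableEq κ] (s t : Finset κ) (f : κ → ℝ)
    (hf : ∀ x, 0 ≤ f x) : ∑ y ∈ s ∪ t, f y ≤ ∑ y ∈ s, f y + ∑ y ∈ t, f y := by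
  rw [← Finset.sum_union_inter]
  exact le_add_of_nonneg_right (Finset.sum_nonneg fun _ _ => hf _)

/-- The union bound over the outcomes of the exploration. -/
theorem binomialProb_le_of_outcome {k n q B T D v₁ e₁ : ℕ} (hn1 : 1 ≤ n) {μ ε δ b p N M : ℝ}
    (hb : 0 ≤ b) (hb1 : b ≤ 1) (hp : 0 ≤ p) (hp1 : p ≤ 1)
    (hpb : p ≤ b * (n : ℝ) ^ (-μ)) (hN : 1 ≤ N) (hM : 1 ≤ M)
    {C : Finset (Finset (Finset (Fin n)))} (hC : ∀ F ∈ C, (∀ e ∈ F, e.card = k) ∧ F.card = e₁)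
    (hCcard : C.card ≤ n ^ v₁)
    (hreg : (2 : ℝ) ^ (k * q) * ((k * q + 1 : ℕ) * numSets k q k * b) ≤ 1 / 4)
    (hfree : (2 : ℝ) ^ (k * q) * ((k * q + 1 : ℕ) * numSets k q (k * (e₁ + T * q)) * b) ≤ M / 4)
    (hdeg : N * M * ((k * q + 1 : ℕ) * numSets k q (k * (e₁ + T * q)) * b * (n : ℝ) ^ (-ε)) ≤
      1 / 4)
    (hMn : M ≤ n) (hTn : (T : ℝ) ≤ n) (hT : (n : ℝ) ^ (v₁ + 2) ≤ 2 ^ T)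
    (hD : (n : ℝ) ^ (v₁ + 3) ≤ N ^ D) {P : KGraph.{0} k → Prop}
    (hP : ∀ E, P (onFin k n E) →
      (∃ σ ∈ reach k μ ε q C T, σ.1 ⊆ E.map (Function.Embedding.subtype _)) ∨
      (∃ t < T, ∃ σ ∈ reach k μ ε q C t, D ≤ σ.2.2 ∧
        σ.1 ⊆ E.map (Function.Embedding.subtype _)) ∨
      (∃ J ⊆ E.map (Function.Embedding.subtype _), Grow k μ δ B ∅ ∅ J)) :
    binomialProb k n p P ≤
      1 / n + 1 / n + (k * B + 1 : ℕ) * numSets k B 0 * (n : ℝ) ^ (-δ) := by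
  classical
  have hn0 : (0 : ℝ) < n := by exact_mod_cast hn1
  have hf0 : ∀ g : Finset (Finset (Fin n)), 0 ≤ p ^ g.card := fun g => pow_nonneg hp _
  have hM0 : 0 < M := by linarith
  have hN0 : 0 < N := by linarith
  set I₁ := (reach k μ ε q C T).image Prod.fst with hI₁
  set I₂ := (Finset.range T).biUnion fun t =>
    ((reach k μ ε q C t).filter fun σ => D ≤ σ.2.2).image Prod.fst with hI₂
  set I₃ := Finset.univ.filter fun J : Finset (Finset (Fin n)) => Grow k μ δ B ∅ ∅ J with hI₃
  have hmem : ∀ E, P (onFin k n E) →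
      ∃ g ∈ I₁ ∪ I₂ ∪ I₃, g ⊆ E.map (Function.Embedding.subtype _) := by
    intro E hE
    simp only [Finset.mem_union]
    rcases hP E hE with ⟨σ, hσ, hsub⟩ | ⟨t, ht, σ, hσ, hd, hsub⟩ | ⟨J, hJ, hg⟩
    · exact ⟨σ.1, Or.inl (Or.inl (Finset.mem_image_of_mem _ hσ)), hsub⟩
    · exact ⟨σ.1, Or.inl (Or.inr (Finset.mem_biUnion.2 ⟨t, Finset.mem_range.2 ht,
        Finset.mem_image_of_mem _ (Finset.mem_filter.2 ⟨hσ, hd⟩)⟩)), hsub⟩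
    · exact ⟨J, Or.inr (Finset.mem_filter.2 ⟨Finset.mem_univ _, hg⟩), hJ⟩
  have hweight : ∀ t ≤ T, ∑ σ ∈ reach k μ ε q C t, expWeight p N M σ ≤
      (1 / 2) ^ t * ((n : ℝ) ^ v₁ * n) := by
    intro t ht
    refine (sum_reach_le (Fintype.card_fin n) hn1 hb hb1 hp hp1 hpb hN hM hC hreg hfree hdeg
      t ht).trans ?_
    have : (C.card : ℝ) ≤ (n : ℝ) ^ v₁ := by exact_mod_cast hCcard
    gcongr
  have hif : ∀ σ : ExpState (Fin n), (1 : ℝ) ≤ if σ.2.1 = ∅ then M else 1 := fun σ => by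
    split_ifs <;> linarith
  have h1 : ∑ g ∈ I₁, p ^ g.card ≤ 1 / n := by
    refine (sum_image_le_sum _ _ _ hf0).trans ?_
    calc ∑ σ ∈ reach k μ ε q C T, p ^ σ.1.card
        ≤ ∑ σ ∈ reach k μ ε q C T, expWeight p N M σ := by
          refine Finset.sum_le_sum fun σ _ => ?_
          unfold expWeight
          have h2 : (1 : ℝ) ≤ N ^ σ.2.2 := one_le_pow₀ hN
          have h3 := hif σ
          calc p ^ σ.1.card = p ^ σ.1.card * 1 * 1 := by ring
            _ ≤ _ := mul_le_mul (mul_le_mul_of_nonneg_left h2 (hf0 _)) h3 zero_le_one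
                (by positivity)
      _ ≤ (1 / 2) ^ T * ((n : ℝ) ^ v₁ * n) := hweight T le_rfl
      _ ≤ 1 / n := by
          rw [one_div_pow, div_mul_eq_mul_div, one_mul, div_le_div_iff₀ (by positivity) hn0, one_mul]
          calc (n : ℝ) ^ v₁ * n * n = (n : ℝ) ^ (v₁ + 2) := by ring
            _ ≤ _ := hT
  have h2 : ∑ g ∈ I₂, p ^ g.card ≤ 1 / n := by
    refine (sum_biUnion_le_sum _ _ _ hf0).trans ?_
    -- Markov's inequality for N^d: at least `D` degenerate steps cost a factor N^(-D).
    have hstep : ∀ t ∈ Finset.range T, ∑ g ∈ ((reach k μ ε q C t).filter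
        fun σ => D ≤ σ.2.2).image Prod.fst, p ^ g.card ≤ (N ^ D)⁻¹ * ((n : ℝ) ^ v₁ * n) := by
      intro t ht
      refine (sum_image_le_sum _ _ _ hf0).trans ?_
      calc ∑ σ ∈ (reach k μ ε q C t).filter fun σ => D ≤ σ.2.2, p ^ σ.1.card
          ≤ ∑ σ ∈ (reach k μ ε q C t).filter fun σ => D ≤ σ.2.2,
            (N ^ D)⁻¹ * expWeight p N M σ := by
            refine Finset.sum_le_sum fun σ hσ => ?_
            rw [le_inv_mul_iff₀ (by positivity)]
            unfold expWeight
            have h3 : N ^ D ≤ N ^ σ.2.2 := pow_le_pow_right₀ hN (Finset.mem_filter.1 hσ).2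
            have h4 := hif σ
            calc N ^ D * p ^ σ.1.card = p ^ σ.1.card * N ^ D * 1 := by ring
              _ ≤ _ := mul_le_mul (mul_le_mul_of_nonneg_left h3 (hf0 _)) h4 zero_le_one
                (by positivity)
        _ ≤ ∑ σ ∈ reach k μ ε q C t, (N ^ D)⁻¹ * expWeight p N M σ := by
            refine Finset.sum_le_sum_of_subset_of_nonneg (Finset.filter_subset _ _) ?_
            intro σ _ _
            unfold expWeight
            have h4 := hif σ
            positivity
        _ ≤ (N ^ D)⁻¹ * ((n : ℝ) ^ v₁ * n) := by
            rw [← Finset.mul_sum]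
            refine mul_le_mul_of_nonneg_left ((hweight t (Finset.mem_range.1 ht).le).trans ?_)
              (by positivity)
            refine mul_le_of_le_one_left (by positivity) (pow_le_one₀ ?_ ?_) <;> norm_num
    refine (Finset.sum_le_sum hstep).trans ?_
    rw [Finset.sum_const, Finset.card_range, nsmul_eq_mul, inv_mul_eq_div, mul_div_assoc',
      div_le_div_iff₀ (by positivity) hn0, one_mul]
    calc (T : ℝ) * ((n : ℝ) ^ v₁ * n) * n ≤ n * ((n : ℝ) ^ v₁ * n) * n := by gcongr
      _ = (n : ℝ) ^ (v₁ + 3) := by ring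
      _ ≤ _ := hD
  -- A dense bounded set is a single growth step from the empty set, so the same count applies.
  have h3 : ∑ g ∈ I₃, p ^ g.card ≤ (k * B + 1 : ℕ) * numSets k B 0 * (n : ℝ) ^ (-δ) := by
    have := sum_grow_le (q := B) (k := k) (δ := δ) (μ := μ) (Fintype.card_fin n) hn1 hb hb1 hp hpb
      ∅ ∅
    simp only [Finset.sdiff_empty, Finset.card_empty] at this
    refine le_trans (le_of_eq ?_) (this.trans ?_)
    · congr!
    · refine mul_le_mul_of_nonneg_right ?_ (by positivity)
      exact mul_le_of_le_one_right (by positivity) hb1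
  refine (binomialProb_le_sum hp hp1 _ hmem).trans ?_
  exact (sum_union_le _ _ _ hf0).trans (add_le_add ((sum_union_le _ _ _ hf0).trans
    (add_le_add h1 h2)) h3)

/-- If the small edge sets that force a copy are denser than `1 / μ`, then a random `k`-graph
at density at most `b * n ^ (-μ)` forces no copy, asymptotically almost surely. -/
theorem exists_tendsto_binomialProb {k v₁ e₁ e₂ : ℕ} {μ ν : ℝ} (hμ : 0 < μ) (hμν : μ ≤ ν)
    (hν : ν < 1) (C₁ C₂ : ∀ n, Finset (Finset (Finset (Fin n))))
    (hC₁ : ∀ n, ∀ F ∈ C₁ n, IsPiece k μ ν F ∧ F.card = e₁)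
    (hC₂ : ∀ n, ∀ F ∈ C₂ n, IsPiece k ν ν F ∧ F.card = e₂)
    (hcard : ∀ n, (C₁ n).card ≤ n ^ v₁)
    (hdense : ∀ n, ∀ S : Finset (Finset (Fin n)), (∀ e ∈ S, e.card = k) →
      (∃ L₁ ⊆ C₁ n, ∃ L₂ ⊆ C₂ n, Forces L₁ L₂ ∧ ∀ F ∈ L₁ ∪ L₂, F ⊆ S) →
      ∃ J ⊆ S, wt μ J < 0)
    {P : KGraph.{0} k → Prop}
    (hP : ∀ n E, P (onFin k n E) →
      Forces ((C₁ n).filter (· ⊆ E.map (Function.Embedding.subtype _)))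
        ((C₂ n).filter (· ⊆ E.map (Function.Embedding.subtype _)))) :
    ∃ b : ℝ, 0 < b ∧ ∀ p : ℕ → ℝ, (∀ n, 0 ≤ p n ∧ p n ≤ 1) →
      (∀ᶠ n : ℕ in atTop, p n ≤ b * (n : ℝ) ^ (-μ)) →
      Tendsto (fun n : ℕ => binomialProb k n (p n) P) atTop (𝓝 0) := by
  classical
  -- `q` bounds both a flower and a single copy of H₁. Below, `D` makes (n^(ε/4))^D at least n^(v₁ +
  -- 3), and `B` bounds the edges of a closed state with fewer than `D` degenerate steps.
  set q := e₂ + e₂ * e₁ + e₁ with hq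
  obtain ⟨ε, hε0, hε1, hε⟩ := exists_weight_gap μ (k * q) q
  set D := ⌈(4 / ε) * (v₁ + 3)⌉₊ with hDdef
  set B := e₁ + (k * q + 1) * D * q with hB
  obtain ⟨δ, hδ0, hδ1, hδ⟩ := exists_weight_gap μ (k * B) B
  set X : ℝ := (2 : ℝ) ^ (k * q) * ((k * q + 1 : ℕ) * numSets k q k) with hX
  have hX0 : 0 < X := by
    have : 0 < numSets k q k := by unfold numSets; positivity
    positivity
  refine ⟨min 1 (1 / (4 * X)), by positivity, fun p hp hpb => ?_⟩
  set b := min 1 (1 / (4 * X)) with hb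
  have hb0 : 0 ≤ b := by positivity
  have hb1 : b ≤ 1 := min_le_left _ _
  have hreg : (2 : ℝ) ^ (k * q) * ((k * q + 1 : ℕ) * numSets k q k * b) ≤ 1 / 4 := by
    calc _ = X * b := by rw [hX]; ring
      _ ≤ X * (1 / (4 * X)) := mul_le_mul_of_nonneg_left (min_le_right _ _) hX0.le
      _ = 1 / 4 := by field_simp
  -- Chosen so that 2^T ≥ n^(v₁ + 2), which beats the n^v₁ starting copies and `M` ≤ n.
  set T : ℕ → ℕ := fun n => (v₁ + 2) * (Nat.log 2 n + 1) with hT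
  set Z : ℝ := 4 * ((2 : ℝ) ^ (k * q) * (k * q + 1 : ℕ)) with hZ
  have hlim : Tendsto (fun n : ℕ => 1 / (n : ℝ) + 1 / n +
      (k * B + 1 : ℕ) * numSets k B 0 * (n : ℝ) ^ (-δ)) atTop (𝓝 0) := by
    have h1 : Tendsto (fun n : ℕ => 1 / (n : ℝ)) atTop (𝓝 0) :=
      tendsto_one_div_atTop_nhds_zero_nat
    have h2 : Tendsto (fun n : ℕ => (n : ℝ) ^ (-δ)) atTop (𝓝 0) :=
      (tendsto_rpow_neg_atTop hδ0).comp tendsto_natCast_atTop_atTop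
    simpa using (h1.add h1).add (h2.const_mul (((k * B + 1 : ℕ) : ℝ) * numSets k B 0))
  refine tendsto_of_tendsto_of_tendsto_of_le_of_le' tendsto_const_nhds hlim ?_ ?_
  · refine Eventually.of_forall fun n => ?_
    unfold binomialProb
    refine Finset.sum_nonneg fun E _ => ?_
    have h1 := (hp n).1
    have h2 : 0 ≤ 1 - p n := by linarith [(hp n).2]
    split_ifs <;> positivity
  filter_upwards [hpb, eventually_ge_atTop 1,
    eventually_numSets_le k q e₁ (v₁ + 2) (Z := Z) (by positivity)
      (show 0 < ε / 4 by positivity),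
    eventually_log_pow_le ((v₁ + 2 : ℕ) : ℝ) 1 one_pos] with n hpn hn1 hnum hlog
  have hn1' : (1 : ℝ) ≤ n := by exact_mod_cast hn1
  have hn0 : (0 : ℝ) < n := by linarith
  have hM : 1 ≤ (n : ℝ) ^ (ε / 4) := Real.one_le_rpow hn1' (by positivity)
  have hMn : (n : ℝ) ^ (ε / 4) ≤ n := by
    conv_rhs => rw [← Real.rpow_one (n : ℝ)]
    exact Real.rpow_le_rpow_of_exponent_le hn1' (by linarith)
  set Y : ℝ := ((numSets k q (k * (e₁ + T n * q)) : ℕ) : ℝ) with hY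
  have hY0 : 0 ≤ Y := by positivity
  have hnum' : Z * Y ≤ (n : ℝ) ^ (ε / 4) := hnum
  refine binomialProb_le_of_outcome (q := q) (B := B) (T := T n) (D := D) (v₁ := v₁) (e₁ := e₁)
    (μ := μ) (ε := ε) (N := (n : ℝ) ^ (ε / 4)) (M := (n : ℝ) ^ (ε / 4)) (C := C₁ n)
    hn1 hb0 hb1 (hp n).1 (hp n).2 hpn hM hM
    (fun F hF => ⟨(hC₁ n F hF).1.uniform, (hC₁ n F hF).2⟩) (hcard n) hreg ?_ ?_ hMn ?_ ?_ ?_ ?_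
  · calc (2 : ℝ) ^ (k * q) * ((k * q + 1 : ℕ) * Y * b) = Z * Y * b / 4 := by rw [hZ]; ring
      _ ≤ Z * Y * 1 / 4 := by gcongr
      _ ≤ (n : ℝ) ^ (ε / 4) / 4 := by linarith
  · have h2 : (1 : ℝ) ≤ 2 ^ (k * q) := one_le_pow₀ one_le_two
    have h3 : (k * q + 1 : ℕ) * Y * b ≤ (n : ℝ) ^ (ε / 4) / 4 := by
      calc (k * q + 1 : ℕ) * Y * b ≤ (2 : ℝ) ^ (k * q) * ((k * q + 1 : ℕ) * Y * 1) := by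
            rw [← one_mul (((k * q + 1 : ℕ) : ℝ) * Y * b)]
            gcongr
        _ = Z * Y / 4 := by rw [hZ]; ring
        _ ≤ _ := by linarith
    -- Three factors n^(ε/4), from `N`, `M` and the polylogarithmic count, against n^(-ε).
    calc (n : ℝ) ^ (ε / 4) * (n : ℝ) ^ (ε / 4) * ((k * q + 1 : ℕ) * Y * b * (n : ℝ) ^ (-ε))
        ≤ (n : ℝ) ^ (ε / 4) * (n : ℝ) ^ (ε / 4) * ((n : ℝ) ^ (ε / 4) / 4 * (n : ℝ) ^ (-ε)) := by
          gcongr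
      _ = (n : ℝ) ^ (ε / 4 + ε / 4 + ε / 4 + -ε) / 4 := by
          rw [Real.rpow_add hn0, Real.rpow_add hn0, Real.rpow_add hn0]; ring
      _ ≤ 1 / 4 := by
          have : (n : ℝ) ^ (ε / 4 + ε / 4 + ε / 4 + -ε) ≤ 1 :=
            Real.rpow_le_one_of_one_le_of_nonpos hn1' (by linarith)
          linarith
  · rw [pow_one, Real.rpow_one] at hlog
    rw [hT]
    exact_mod_cast hlog
  · rw [hT]
    have h1 : n ≤ 2 ^ (Nat.log 2 n + 1) := (Nat.lt_pow_succ_log_self one_lt_two n).le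
    have h2 : n ^ (v₁ + 2) ≤ 2 ^ ((v₁ + 2) * (Nat.log 2 n + 1)) := by
      rw [mul_comm, pow_mul]
      exact Nat.pow_le_pow_left h1 _
    exact_mod_cast h2
  · rw [← Real.rpow_mul_natCast hn0.le, ← Real.rpow_natCast]
    refine Real.rpow_le_rpow_of_exponent_le hn1' ?_
    have h1 : (4 / ε) * (v₁ + 3) ≤ D := Nat.le_ceil _
    push_cast
    calc (v₁ : ℝ) + 3 = ε / 4 * ((4 / ε) * (v₁ + 3)) := by field_simp
      _ ≤ ε / 4 * D := by gcongr
  · intro E hE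
    obtain ⟨L₁, hL₁, L₂, hL₂, hcore⟩ := (hP n E hE).exists_core
    have hL₁' := hL₁.trans (Finset.filter_subset _ _)
    have hL₂' := hL₂.trans (Finset.filter_subset _ _)
    have hsub : ∀ F ∈ L₁ ∪ L₂, F ⊆ E.map (Function.Embedding.subtype _) := by
      intro F hF
      rcases Finset.mem_union.1 hF with h | h
      exacts [(Finset.mem_filter.1 (hL₁ h)).2, (Finset.mem_filter.1 (hL₂ h)).2]
    have hne : L₁.Nonempty := by
      by_contra hempty
      rw [Finset.not_nonempty_iff_eq_empty] at hempty
      -- With `L₁` empty, colouring all edges of `L₂` red would be good, as copies are nonempty.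
      rcases hcore.forces (L₂.biUnion id) with ⟨F, hF, -⟩ | ⟨F, hF, hd⟩
      · simp [hempty] at hF
      · have h1 : F = ∅ := by
          rw [← Finset.disjoint_self_iff_empty]
          exact Finset.disjoint_of_subset_right (Finset.subset_biUnion_of_mem id hF) hd
        have h2 := (hC₂ n F (hL₂' hF)).1.two_lt_card (hμ.trans_le hμν) le_rfl hν
        simp [h1] at h2
    rcases exploration_outcome hcore hμ hμν hν hL₁' hne (hC₁ n)
      (fun F hF => hC₂ n F (hL₂' hF)) (q := q) (by omega) (by omega) hsub hε (T n) D with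
      h | h | ⟨S, hSE, hScard, hall⟩
    · exact Or.inl h
    · exact Or.inr (Or.inl h)
    · right; right
      have hSu : ∀ e ∈ S, e.card = k := by
        intro e he
        obtain ⟨x, -, rfl⟩ := Finset.mem_map.1 (hSE he)
        exact x.2
      obtain ⟨J, hJS, hJ⟩ := hdense n S hSu ⟨L₁, hL₁', L₂, hL₂', hcore.forces, hall⟩
      have hJu : ∀ e ∈ J, e.card = k := fun e he => hSu e (hJS he)
      have hJB : J.card ≤ B := (Finset.card_le_card hJS).trans hScard
      refine ⟨J, hJS.trans hSE, hJu, hJB, ?_, ?_, ?_⟩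
      · simp [cov]
      · rw [Finset.sdiff_empty, Finset.nonempty_iff_ne_empty]
        rintro rfl
        simp [wt, cov] at hJ
      · have : cov (∅ : Finset (Finset (Fin n))) = ∅ := by simp [cov]
        rw [this, Finset.sdiff_empty, Finset.sdiff_empty]
        exact hδ _ _ ((card_cov_le hJu).trans (Nat.mul_le_mul_left k hJB)) hJB hJ

end Probability

end KGraph
-- Copies of the hearts as pieces, and the link to arrowing
namespace KGraph

section Copies

theorem IsPiece.map {V W : Type*} [DecidableEq V] [DecidableEq W] {k : ℕ} {μ ν : ℝ}
    {F : Finset (Finset V)} (h : IsPiece k μ ν F) (f : V ↪ W) :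
    IsPiece k μ ν (F.map (Finset.mapEmbedding f).toEmbedding) := by
  have hcov : ∀ X : Finset (Finset V),
      cov (X.map (Finset.mapEmbedding f).toEmbedding) = (cov X).map f := by
    intro X
    ext x
    simp only [mem_cov, Finset.mem_map]
    constructor
    · rintro ⟨-, ⟨e, he, rfl⟩, hx⟩
      obtain ⟨y, hy, rfl⟩ := Finset.mem_map.1 hx
      exact ⟨y, ⟨e, he, hy⟩, rfl⟩
    · rintro ⟨y, ⟨e, he, hy⟩, rfl⟩
      exact ⟨_, ⟨e, he, rfl⟩, Finset.mem_map_of_mem f hy⟩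
  refine ⟨?_, ?_, ?_, ?_⟩
  · intro e he
    obtain ⟨e', he', rfl⟩ := Finset.mem_map.1 he
    exact (Finset.card_map f).trans (h.uniform e' he')
  · rw [hcov, Finset.card_map]; exact h.lt_cov
  · rw [hcov, Finset.card_map, Finset.card_map]; exact h.wt_eq
  · intro J U hJ hJU hU hk
    obtain ⟨J', hJ', rfl⟩ := Finset.subset_map_iff.1 hJ.1
    rw [hcov] at hJU hU
    obtain ⟨U', hU', rfl⟩ := Finset.subset_map_iff.1 hU
    rw [Finset.card_map] at hk
    rw [Finset.card_map, Finset.card_map]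
    refine h.lt_wt J' U' ⟨hJ', fun hF => hJ.2 (Finset.map_subset_map.2 hF)⟩
      (Finset.map_subset_map.1 hJU) hU' hk

variable {k : ℕ}

/-- `H` is strictly balanced for the weight `v - μ * e`, its own weight being `k - ν`. -/
structure WeightBalanced (H : KGraph.{u} k) (μ ν : ℝ) : Prop where
  lt_card : k < Fintype.card H.V
  wt_eq : (Fintype.card H.V : ℝ) - μ * H.edges.card = k - ν
  lt_wt : ∀ J : H.Sub, J.IsProper → k < J.verts.card →
    (k : ℝ) - ν < J.verts.card - μ * J.edges.card

/-- What needs proof is that no vertex is isolated: deleting such a vertex would lower the weight by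
1, against strict balancedness. -/
theorem WeightBalanced.isPiece {H : KGraph.{u} k} [DecidableEq H.V] {μ ν : ℝ} (hμ : 0 < μ)
    (hμν : μ ≤ ν) (hν : ν < 1) (h : H.WeightBalanced μ ν) : IsPiece k μ ν H.edges := by
  have hcov : cov H.edges = Finset.univ := by
    by_contra hne
    obtain ⟨x, hx⟩ : ∃ x, x ∉ cov H.edges := by
      by_contra! hall
      exact hne (Finset.eq_univ_iff_forall.2 hall)
    have hsub : cov H.edges ⊆ Finset.univ.erase x := fun y hy =>
      Finset.mem_erase.2 ⟨fun hyx => hx (hyx ▸ hy), Finset.mem_univ y⟩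
    have hcard : (Finset.univ.erase x : Finset H.V).card + 1 = Fintype.card H.V :=
      Finset.card_erase_add_one (Finset.mem_univ x)
    have hcard' : ((Finset.univ.erase x : Finset H.V).card : ℝ) + 1 = Fintype.card H.V := by
      exact_mod_cast hcard
    have heq := h.wt_eq
    rcases Nat.lt_or_ge k (Finset.univ.erase x : Finset H.V).card with hk | hk
    · have := h.lt_wt ⟨Finset.univ.erase x, H.edges, subset_rfl,
        fun e he => (subset_cov he).trans hsub⟩
        (Or.inl (Finset.erase_ne_self.2 (Finset.mem_univ x))) hk
      simp only at this
      linarith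
    · have h1 := card_le_one_of_cov_subset H.card_edge hsub hk
      have h1' : (H.edges.card : ℝ) ≤ 1 := by exact_mod_cast h1
      have h2 : (k : ℝ) + 1 ≤ Fintype.card H.V := by exact_mod_cast h.lt_card
      nlinarith
  refine ⟨H.card_edge, ?_, ?_, ?_⟩
  · rw [hcov]; exact h.lt_card
  · rw [hcov]; exact h.wt_eq
  · intro J W hJ hJW hW hk
    exact h.lt_wt ⟨W, J, hJ.1, fun e he => (subset_cov he).trans hJW⟩ (Or.inr hJ.ne) hk

/-- Strictness forces the maximum to be attained at `H` itself, and m_k > 1 rules out the cases 1/k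
and 0 of `dK`. Clearing denominators gives the weights. -/
theorem StrictlyKBalanced.weightBalanced {H : KGraph.{u} k} (hk : 2 ≤ k)
    (hb : H.StrictlyKBalanced) (hm : 1 < H.mK) : H.WeightBalanced (1 / H.mK) (1 / H.mK) := by
  obtain ⟨J, hJ⟩ := (isGreatest_iSup_sub H fun J => dK k J.verts.card J.edges.card).1
  change _ = H.mK at hJ
  simp only at hJ
  have hJtop : ¬ J.IsProper := fun h => (hb J h).ne hJ
  unfold Sub.IsProper at hJtop
  push Not at hJtop
  rw [hJtop.1, hJtop.2, Finset.card_univ] at hJ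
  have hm0 : 0 < H.mK := by linarith
  have hk' : (2 : ℝ) ≤ k := by exact_mod_cast hk
  unfold dK at hJ
  split_ifs at hJ with h1 h2
  · have hlt : (k : ℝ) + 1 ≤ Fintype.card H.V := by exact_mod_cast h1.2
    refine ⟨h1.2, ?_, ?_⟩
    · rw [div_eq_iff (by linarith)] at hJ
      field_simp
      linarith
    · intro J hJp hJk
      have := hb J hJp
      have hJk' : (k : ℝ) + 1 ≤ J.verts.card := by exact_mod_cast hJk
      have hinv : 0 < 1 / H.mK := by positivity
      by_cases he : 1 ≤ J.edges.card
      · rw [dK, if_pos ⟨he, hJk⟩, div_lt_iff₀ (by linarith)] at this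
        have h3 : 1 / H.mK * (J.edges.card - 1) < J.verts.card - k := by
          rw [one_div, inv_mul_lt_iff₀ hm0]; exact this
        linarith
      · have he0 : J.edges.card = 0 := by omega
        rw [he0]
        push_cast
        linarith
  · exfalso
    have : 1 / (k : ℝ) ≤ 1 / 2 := one_div_le_one_div_of_le two_pos hk'
    linarith
  · linarith

theorem dKPair_of_le {H₂ : KGraph.{w} k} (hne : H₂.edges.Nonempty) {v e : ℕ} (hv : k ≤ v) :
    dKPair v e H₂ = (e : ℝ) / ((v : ℝ) - k + 1 / H₂.mK) := by
  rw [dKPair, if_pos ⟨hne, hv⟩]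

/-- On at least k vertices, d_k(J,H₂) ≤ m_k(H₂) says precisely that `J` has ν-weight at least k - ν,
with equality at `H₁`. Thus μ = ν when the two k-densities agree. -/
theorem mKPair_eq_of_weightBalanced {H₁ : KGraph.{u} k} {H₂ : KGraph.{w} k}
    (hne : H₂.edges.Nonempty) (hm : 1 < H₂.mK)
    (h : H₁.WeightBalanced (1 / H₂.mK) (1 / H₂.mK)) : mKPair H₁ H₂ = H₂.mK := by
  classical
  have hm0 : 0 < H₂.mK := by linarith
  have hν : 0 < 1 / H₂.mK := by positivity
  have hmul : H₂.mK * (1 / H₂.mK) = 1 := by field_simp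
  apply le_antisymm
  · refine ciSup_le fun J => ?_
    by_cases hkv : k ≤ J.verts.card
    · have hkv' : (k : ℝ) ≤ J.verts.card := by exact_mod_cast hkv
      rw [dKPair_of_le hne hkv, div_le_iff₀ (by linarith)]
      have key : (k : ℝ) - 1 / H₂.mK ≤ J.verts.card - 1 / H₂.mK * J.edges.card := by
        rcases hkv.lt_or_eq with hlt | heq
        · by_cases hJ : J.IsProper
          · exact (h.lt_wt J hJ hlt).le
          · unfold Sub.IsProper at hJ
            push Not at hJ
            rw [hJ.1, hJ.2, Finset.card_univ]
            exact h.wt_eq.ge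
        · have h1 := card_le_one_of_cov_subset (J := J.edges) (W := J.verts)
            (fun e he => H₁.card_edge e (J.edges_subset he))
            (Finset.biUnion_subset.2 fun e he => J.subset_verts e he) heq.ge
          have h1' : (J.edges.card : ℝ) ≤ 1 := by exact_mod_cast h1
          rw [← heq]
          nlinarith
      have := mul_le_mul_of_nonneg_left key hm0.le
      nlinarith
    · rw [dKPair, if_neg fun hh => hkv hh.2]; exact hm0.le
  · have hle := (isGreatest_iSup_sub H₁ fun J => dKPair J.verts.card J.edges.card H₂).2
      ⟨⟨Finset.univ, H₁.edges, subset_rfl, fun _ _ => Finset.subset_univ _⟩, rfl⟩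
    refine le_trans (le_of_eq ?_) hle
    simp only [Finset.card_univ]
    have h1 : (k : ℝ) + 1 ≤ Fintype.card H₁.V := by exact_mod_cast h.lt_card
    rw [dKPair_of_le hne h.lt_card.le, eq_div_iff (by linarith)]
    have h2 := congrArg (H₂.mK * ·) h.wt_eq
    simp only [mul_sub, ← mul_assoc, hmul] at h2
    linarith

/-- A single edge is a proper subgraph with d_k(·,H₂) = m_k(H₂), which gives μ < ν. The maximum is
attained at `H₁`, and clearing denominators gives the weights. -/
theorem StrictlyBalancedWrt.weightBalanced {H₁ : KGraph.{u} k} {H₂ : KGraph.{w} k} (hk : 2 ≤ k)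
    (hne₁ : H₁.edges.Nonempty) (hne : H₂.edges.Nonempty) (hm : 1 < H₂.mK) (hlt : H₂.mK < H₁.mK)
    (hb : H₁.StrictlyBalancedWrt H₂) :
    H₂.mK < mKPair H₁ H₂ ∧ H₁.WeightBalanced (1 / mKPair H₁ H₂) (1 / H₂.mK) := by
  have hm0 : 0 < H₂.mK := by linarith
  have hν : 0 < 1 / H₂.mK := by positivity
  have hk' : (2 : ℝ) ≤ k := by exact_mod_cast hk
  have hcardk : k < Fintype.card H₁.V := by
    obtain ⟨J, hJ⟩ := (isGreatest_iSup_sub H₁ fun J => dK k J.verts.card J.edges.card).1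
    change _ = H₁.mK at hJ
    simp only at hJ
    unfold dK at hJ
    split_ifs at hJ with h1 h2
    · exact lt_of_lt_of_le (Nat.lt_of_succ_le h1.2) (Finset.card_le_univ _)
    · have : 1 / (k : ℝ) ≤ 1 / 2 := one_div_le_one_div_of_le two_pos hk'
      linarith
    · linarith
  obtain ⟨e, he⟩ := hne₁
  have hlt' : H₂.mK < mKPair H₁ H₂ := by
    have h1 := hb ⟨e, {e}, by simpa using he, by simp⟩ (Or.inl fun hh => by
      have h2 := H₁.card_edge e he
      simp only at hh
      rw [hh, Finset.card_univ] at h2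
      omega)
    simp only [Finset.card_singleton, H₁.card_edge e he] at h1
    rw [dKPair_of_le hne le_rfl] at h1
    simpa using h1
  set m := mKPair H₁ H₂ with hmdef
  have hm0' : 0 < m := by linarith
  refine ⟨hlt', hcardk, ?_, ?_⟩
  · obtain ⟨J, hJ⟩ := (isGreatest_iSup_sub H₁ fun J => dKPair J.verts.card J.edges.card H₂).1
    change _ = m at hJ
    simp only at hJ
    have hJtop : ¬ J.IsProper := fun h => (hb J h).ne hJ
    unfold Sub.IsProper at hJtop
    push Not at hJtop
    rw [hJtop.1, hJtop.2, Finset.card_univ, dKPair_of_le hne hcardk.le] at hJ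
    have h1 : (k : ℝ) + 1 ≤ Fintype.card H₁.V := by exact_mod_cast hcardk
    rw [div_eq_iff (by linarith)] at hJ
    rw [hJ, ← mul_assoc, one_div_mul_cancel hm0'.ne']
    ring
  · intro J hJ hJk
    have h1 := hb J hJ
    have hJk' : (k : ℝ) + 1 ≤ J.verts.card := by exact_mod_cast hJk
    rw [dKPair_of_le hne hJk.le, div_lt_iff₀ (by linarith)] at h1
    have h3 : 1 / m * J.edges.card < J.verts.card - k + 1 / H₂.mK := by
      rw [one_div, inv_mul_lt_iff₀ hm0']; exact h1
    linarith

theorem IsHeart.weightBalanced {H₁ : KGraph.{u} k} {H₂ : KGraph.{w} k} (hk : 2 ≤ k)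
    (hne₁ : H₁.edges.Nonempty) (hne : H₂.edges.Nonempty) (hm : 1 < H₂.mK) (h : IsHeart H₁ H₂) :
    H₂.mK ≤ mKPair H₁ H₂ ∧ H₁.WeightBalanced (1 / mKPair H₁ H₂) (1 / H₂.mK) ∧
      H₂.WeightBalanced (1 / H₂.mK) (1 / H₂.mK) := by
  refine ⟨?_, ?_, h.2.1.weightBalanced hk hm⟩ <;> rcases h.1.lt_or_eq with hlt | heq
  · exact ((h.2.2.2 hlt).weightBalanced hk hne₁ hne hm hlt).1.le
  · have := (h.2.2.1 heq.symm).weightBalanced hk (heq ▸ hm)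
    rw [← heq] at this
    exact (mKPair_eq_of_weightBalanced hne hm this).ge
  · exact ((h.2.2.2 hlt).weightBalanced hk hne₁ hne hm hlt).2
  · have := (h.2.2.1 heq.symm).weightBalanced hk (heq ▸ hm)
    rw [← heq] at this
    rwa [mKPair_eq_of_weightBalanced hne hm this]

/-- The edge set of the copy of `H` under `f`. -/
def copyEdges (H : KGraph.{u} k) {W : Type*} (f : H.V ↪ W) : Finset (Finset W) :=
  H.edges.map (Finset.mapEmbedding f).toEmbedding

theorem copyEdges_subset_iff {H : KGraph.{u} k} {W : Type*} {f : H.V ↪ W}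
    {R : Finset (Finset W)} : H.copyEdges f ⊆ R ↔ ∀ e ∈ H.edges, e.map f ∈ R := by
  simp [copyEdges, Finset.subset_iff]

open Classical in
/-- The edge sets of the copies of `H` on the vertex set `Fin n`. -/
noncomputable def copies (H : KGraph.{u} k) (n : ℕ) : Finset (Finset (Finset (Fin n))) :=
  Finset.univ.image fun f : H.V ↪ Fin n => H.copyEdges f

theorem mem_copies {H : KGraph.{u} k} {n : ℕ} {F : Finset (Finset (Fin n))} :
    F ∈ H.copies n ↔ ∃ f : H.V ↪ Fin n, H.copyEdges f = F := by
  simp [copies]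

theorem card_copies_le (H : KGraph.{u} k) (n : ℕ) :
    (H.copies n).card ≤ n ^ Fintype.card H.V := by
  classical
  refine Finset.card_image_le.trans ?_
  rw [Finset.card_univ]
  refine (Fintype.card_le_of_injective (fun f : H.V ↪ Fin n => (f : H.V → Fin n))
    DFunLike.coe_injective).trans ?_
  simp

theorem WeightBalanced.isPiece_copies {H : KGraph.{u} k} {μ ν : ℝ} (hμ : 0 < μ)
    (hμν : μ ≤ ν) (hν : ν < 1) (h : H.WeightBalanced μ ν) {n : ℕ} {F : Finset (Finset (Fin n))}
    (hF : F ∈ H.copies n) : IsPiece k μ ν F ∧ F.card = H.edges.card := by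
  classical
  obtain ⟨f, rfl⟩ := mem_copies.1 hF
  exact ⟨(h.isPiece hμ hμν hν).map f, Finset.card_map _⟩

theorem arrows_pair_of_forces {H₁ H₂ : KGraph.{u} k} {n : ℕ} {S : Finset (Finset (Fin n))}
    (hS : ∀ e ∈ S, e.card = k) {L₁ L₂ : Finset (Finset (Finset (Fin n)))}
    (h₁ : L₁ ⊆ H₁.copies n) (h₂ : L₂ ⊆ H₂.copies n) (hF : Forces L₁ L₂)
    (hsub : ∀ F ∈ L₁ ∪ L₂, F ⊆ S) :
    Arrows (KGraph.mk (Fin n) S hS : KGraph.{0} k) ![H₁, H₂] := by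
  classical
  intro c
  -- Red is colour 0; a copy of H₂ disjoint from the red edges has colour 1 throughout.
  rcases hF (S.filter fun e => ∃ h : e ∈ S, c ⟨e, h⟩ = 0) with ⟨F, hF, hFR⟩ | ⟨F, hF, hFR⟩
  · obtain ⟨f, rfl⟩ := mem_copies.1 (h₁ hF)
    refine ⟨0, f, fun e he => ?_⟩
    exact (Finset.mem_filter.1 (copyEdges_subset_iff.1 hFR e he)).2
  · obtain ⟨f, rfl⟩ := mem_copies.1 (h₂ hF)
    refine ⟨1, f, fun e he => ?_⟩
    have heS := copyEdges_subset_iff.1 (hsub _ (Finset.mem_union_right _ hF)) e he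
    refine ⟨heS, ?_⟩
    have hne : c ⟨e.map f, heS⟩ ≠ 0 := fun h0 => by
      refine Finset.disjoint_left.1 hFR (copyEdges_subset_iff.1 subset_rfl e he) ?_
      exact Finset.mem_filter.2 ⟨heS, heS, h0⟩
    exact Fin.eq_one_of_ne_zero _ hne

/-- Use only the first two colours, the first on `R` and the second elsewhere. Every `H i` has an
edge, so a monochromatic copy belongs to one of these colours. -/
theorem Arrows.forces {n r : ℕ} (hr : 2 ≤ r) {H : Fin r → KGraph.{u} k}
    (hne : ∀ i, (H i).edges.Nonempty) {E : Finset {e : Finset (Fin n) // e.card = k}}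
    (h : (onFin k n E).Arrows H) :
    Forces (((H ⟨0, Nat.lt_of_succ_lt hr⟩).copies n).filter
        (· ⊆ E.map (Function.Embedding.subtype _)))
      (((H ⟨1, hr⟩).copies n).filter (· ⊆ E.map (Function.Embedding.subtype _))) := by
  classical
  intro R
  obtain ⟨i, f, hf⟩ : ∃ (i : Fin r) (f : (H i).V ↪ Fin n), ∀ e ∈ (H i).edges,
      e.map f ∈ E.map (Function.Embedding.subtype _) ∧
        (if e.map f ∈ R then ⟨0, Nat.lt_of_succ_lt hr⟩ else ⟨1, hr⟩) = i := by
    let c : Finset (Fin n) → Fin r := fun e =>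
      if e ∈ R then ⟨0, Nat.lt_of_succ_lt hr⟩ else ⟨1, hr⟩
    obtain ⟨i, f, hf⟩ := h fun e => c e.1
    exact ⟨i, f, fun e he => ⟨(hf e he).1, (hf e he).2⟩⟩
  have hmem : (H i).copyEdges f ⊆ E.map (Function.Embedding.subtype _) :=
    copyEdges_subset_iff.2 fun e he => (hf e he).1
  obtain ⟨e, he⟩ := hne i
  by_cases heR : e.map f ∈ R
  · have hi : i = ⟨0, Nat.lt_of_succ_lt hr⟩ := by
      have hc := (hf e he).2
      rw [if_pos heR] at hc
      exact hc.symm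
    subst hi
    refine Or.inl ⟨_, Finset.mem_filter.2 ⟨mem_copies.2 ⟨f, rfl⟩, hmem⟩, ?_⟩
    refine copyEdges_subset_iff.2 fun g hg => ?_
    by_contra hgR
    have hc := (hf g hg).2
    rw [if_neg hgR] at hc
    simp at hc
  · have hi : i = ⟨1, hr⟩ := by
      have hc := (hf e he).2
      rw [if_neg heR] at hc
      exact hc.symm
    subst hi
    refine Or.inr ⟨_, Finset.mem_filter.2 ⟨mem_copies.2 ⟨f, rfl⟩, hmem⟩, ?_⟩
    rw [Finset.disjoint_left]
    intro g' hg' hgR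
    obtain ⟨g, hg, rfl⟩ := Finset.mem_map.1 hg'
    have hc := (hf g hg).2
    rw [if_pos (show g.map f ∈ R from hgR)] at hc
    simp at hc

/-- A subgraph of density above m₀ has |V| < |E|/m₀, and dropping its isolated vertices only lowers
the weight. -/
theorem exists_wt_neg_of_lt_m {n : ℕ} {S : Finset (Finset (Fin n))} (hS : ∀ e ∈ S, e.card = k)
    {m₀ : ℝ} (hm₀ : 0 < m₀) (h : m₀ < (KGraph.mk (Fin n) S hS : KGraph.{0} k).m) :
    ∃ J ⊆ S, wt (1 / m₀) J < 0 := by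
  obtain ⟨J, hJ⟩ := (isGreatest_iSup_sub (KGraph.mk (Fin n) S hS : KGraph.{0} k)
    fun J => d J.verts.card J.edges.card).1
  simp only at hJ
  change _ = (KGraph.mk (Fin n) S hS : KGraph.{0} k).m at hJ
  rw [← hJ] at h
  unfold d at h
  split_ifs at h with hv
  · refine ⟨J.edges, J.edges_subset, ?_⟩
    have hv' : (0 : ℝ) < J.verts.card := by exact_mod_cast hv
    rw [lt_div_iff₀ hv'] at h
    have h1 : (cov J.edges).card ≤ J.verts.card :=
      Finset.card_le_card (Finset.biUnion_subset.2 fun e he => J.subset_verts e he)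
    have h2 : ((cov J.edges).card : ℝ) ≤ J.verts.card := by exact_mod_cast h1
    have h3 : (J.verts.card : ℝ) < 1 / m₀ * J.edges.card := by
      rw [one_div, lt_inv_mul_iff₀ hm₀]; exact h
    unfold wt
    linarith
  · linarith

end Copies

end KGraph

/-! ### The theorem -/

theorem theorem1p8 {k r : ℕ} (hk : 2 ≤ k) (hr : 2 ≤ r) (H : Fin r → KGraph.{u} k)
    (hne : ∀ i, (H i).edges.Nonempty)
    (hmono : ∀ i j : Fin r, i ≤ j → (H j).mK ≤ (H i).mK)
    (hm₂ : 1 < (H ⟨1, hr⟩).mK)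
    (hheart : KGraph.IsHeart (H ⟨0, Nat.lt_of_succ_lt hr⟩) (H ⟨1, hr⟩))
    (hcol : ∀ G : KGraph.{0} k,
      G.m ≤ KGraph.mKPair (H ⟨0, Nat.lt_of_succ_lt hr⟩) (H ⟨1, hr⟩) →
        ¬ G.Arrows ![H ⟨0, Nat.lt_of_succ_lt hr⟩, H ⟨1, hr⟩]) :
    ∃ b : ℝ, 0 < b ∧ ∀ p : ℕ → ℝ, (∀ n, 0 ≤ p n ∧ p n ≤ 1) →
      (∀ᶠ n : ℕ in atTop, p n ≤ b * (n : ℝ) ^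
        (-(1 / KGraph.mKPair (H ⟨0, Nat.lt_of_succ_lt hr⟩) (H ⟨1, hr⟩)))) →
      Tendsto (fun n : ℕ => KGraph.binomialProb k n (p n) fun G => G.Arrows H) atTop (𝓝 0) := by
  obtain ⟨hle, hb₁, hb₂⟩ := hheart.weightBalanced hk (hne _) (hne _) hm₂
  have hm₂0 : 0 < (H ⟨1, hr⟩).mK := by linarith
  have hm0 := hm₂0.trans_le hle
  have hν : 1 / (H ⟨1, hr⟩).mK < 1 := (div_lt_one hm₂0).2 hm₂
  have hμν := one_div_le_one_div_of_le hm₂0 hle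
  refine KGraph.exists_tendsto_binomialProb (one_div_pos.2 hm0) hμν hν
    (KGraph.copies _) (KGraph.copies _)
    (fun n F hF => hb₁.isPiece_copies (one_div_pos.2 hm0) hμν hν hF)
    (fun n F hF => hb₂.isPiece_copies (one_div_pos.2 hm₂0) le_rfl hν hF)
    (KGraph.card_copies_le _) ?_ (fun n E hE => hE.forces hr hne)
  rintro n S hS ⟨L₁, h₁, L₂, h₂, hF, hsub⟩
  refine KGraph.exists_wt_neg_of_lt_m hS hm0 ?_
  by_contra! hm
  exact hcol _ hm (KGraph.arrows_pair_of_forces hS h₁ h₂ hF hsub)
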